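/- Let $G$ be a totally disconnected locally compact (Hausdorff) group. A compact $G$-space is a compact Hausdorff space $Y$ with a (jointly) continuous action of $G$; $\mathrm{Prob}(Y)$ denotes the set of regular Borel probability measures on $Y$ with the weak-$*$ topology. An action by homeomorphisms on a compact Hausdorff space $Y$ is minimal if all its orbits are dense, and strongly proximal if for every $\mu\in\mathrm{Prob}(Y)$ the closure of the orbit of $\mu$ in $\mathrm{Prob}(Y)$ contains a Dirac measure. A $G$-boundary is a non-empty compact $G$-space on which $G$ acts minimally and strongly proximally. The Furstenberg boundary $\partial_F G$ is the $G$-boundary, which exists and is unique up to isomorphism, of which every $G$-boundary is a factor (a continuous $G$-equivariant image). A closed subgroup $H\le G$ is relatively amenable in $G$ if $H$ fixes an element of $\mathrm{Prob}(Y)$ for every non-empty compact $G$-space $Y$, and $H$ is confined if the closure of its conjugacy class $\{gHg^{-1} : g\in G\}$ in the Chabauty space of closed subgroups of $G$ does not contain the trivial subgroup. Theorem. Suppose that there is a totally disconnected compact $G$-space $X$ such that the action of $G$ on $X$ is faithful and, for every non-empty clopen subset $\alpha\subseteq X$, the rigid stabilizer $\{g\in G : gx=x \text{ for all } x\in X\setminus\alpha\}$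 acts minimally and strongly proximally on $\alpha$. Then no closed subgroup of $G$ is both relatively amenable in $G$ and confined; equivalently, the action of $G$ on its Furstenberg boundary $\partial_F G$ is free, that is, every point of $\partial_F G$ has trivial stabilizer in $G$. -/

import Mathlib

open MeasureTheory Topology

universe u v w

namespace TopDyn

section Actions

/-- `X` is a compact `G`-space: a compact Hausdorff space with a jointly continuous `G`-action. -/
structure IsCompactSpaceOver (G : Type u) (X : Type v) [Group G] [TopologicalSpace G]
    [TopologicalSpace X] [MulAction G X] : Prop where
  compact : CompactSpace X
  hausdorff : T2Space X
  continuous_action : ContinuousSMul G X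

/-- The action of `G` on `X` is strongly proximal: for every (regular) Borel probability measure
`μ` on `X`, the weak-* closure of the orbit of `μ` under push-forward contains a Dirac mass.
The `σ`-algebra is the Borel one; it is uniquely determined by `BorelSpace X`. -/
def StronglyProximal (G : Type u) (X : Type v) [Group G] [TopologicalSpace X]
    [MulAction G X] : Prop :=
  ∀ [MeasurableSpace X] [BorelSpace X] (μ : ProbabilityMeasure X), (μ : Measure X).Regular →
    ∃ x : X, diracProba x ∈ closure
      {ν : ProbabilityMeasure X |
        ∃ g : G, (ν : Measure X) = (μ : Measure X).map (fun y => g • y)}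

/-- `X` is a (topological) `G`-boundary: a non-empty compact `G`-space on which the action is
minimal and strongly proximal. -/
structure IsBoundary (G : Type u) (X : Type v) [Group G] [TopologicalSpace G]
    [TopologicalSpace X] [MulAction G X] : Prop extends IsCompactSpaceOver G X where
  nonempty : Nonempty X
  minimal : MulAction.IsMinimal G X
  stronglyProximal : StronglyProximal G X

/-- `Y` is a factor of `X`: there is a continuous surjective `G`-equivariant map from `X`
to `Y`. -/
def IsFactor (G : Type u) (X : Type v) (Y : Type w) [Group G] [TopologicalSpace X]
    [MulAction G X] [TopologicalSpace Y] [MulAction G Y] : Prop :=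
  ∃ f : X → Y, Continuous f ∧ Function.Surjective f ∧ ∀ (g : G) (x : X), f (g • x) = g • f x

/-- `F` is a Furstenberg boundary of `G`: a `G`-boundary of which every `G`-boundary is a
factor. It is unique up to isomorphism. Every `G`-boundary has a dense orbit, hence is isomorphic
to one that lives in the universe of `G`. -/
structure IsFurstenbergBoundary (G : Type u) (F : Type u) [Group G] [TopologicalSpace G]
    [TopologicalSpace F] [MulAction G F] : Prop extends IsBoundary G F where
  universal : ∀ (Y : Type u) [TopologicalSpace Y] [MulAction G Y],
    IsBoundary G Y → IsFactor G F Y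

/-- The action of `G` on `X` is free: all point stabilizers are trivial. -/
def IsFreeAction (G : Type u) (X : Type v) [Group G] [MulAction G X] : Prop :=
  ∀ x : X, MulAction.stabilizer G x = ⊥

end Actions

section RigidStabilizers

/-- The rigid stabilizer of `α`: the pointwise fixator of the complement of `α`. -/
def rigidStabilizer (G : Type u) {X : Type v} [Group G] [MulAction G X] (α : Set X) :
    Subgroup G :=
  fixingSubgroup G αᶜ

theorem smul_mem_of_mem_rigidStabilizer {G : Type u} {X : Type v} [Group G] [MulAction G X]
    {α : Set X} {g : G} (hg : g ∈ rigidStabilizer G α) {x : X} (hx : x ∈ α) : g • x ∈ α := by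
  by_contra h
  have h1 : g • g • x = g • x := (mem_fixingSubgroup_iff G).1 hg (g • x) h
  rw [MulAction.injective g h1] at h
  exact h hx

/-- The action of the rigid stabilizer of `α` on `α`, by restriction of the action on `X`. -/
instance rigidStabilizerAction (G : Type u) {X : Type v} [Group G] [MulAction G X] (α : Set X) :
    MulAction (rigidStabilizer G α) α where
  smul g x := ⟨(g : G) • (x : X), smul_mem_of_mem_rigidStabilizer g.2 x.2⟩
  one_smul x := Subtype.ext (one_smul G (x : X))
  mul_smul g h x := Subtype.ext (mul_smul (g : G) (h : G) (x : X))

/-- The action of `G` on `X` is piecewise minimal-strongly-proximal: for every non-empty clopen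
`α`, the rigid stabilizer of `α` acts minimally and strongly proximally on `α`. -/
def PiecewiseMinimalStronglyProximal (G : Type u) (X : Type v) [Group G] [TopologicalSpace X]
    [MulAction G X] : Prop :=
  ∀ α : Set X, IsClopen α → α.Nonempty →
    MulAction.IsMinimal (rigidStabilizer G α) α ∧ StronglyProximal (rigidStabilizer G α) α

end RigidStabilizers

section Subgroups

/-- The Chabauty topology on the set of closed subgroups of `G`: a sub-basis is given by the sets
of closed subgroups that avoid a given compact set, and of those that meet a given open set. -/
instance chabautyTopology (G : Type u) [Group G] [TopologicalSpace G] :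
    TopologicalSpace (ClosedSubgroup G) :=
  TopologicalSpace.generateFrom
    ({s | ∃ K : Set G, IsCompact K ∧ s = {H : ClosedSubgroup G | (H : Set G) ∩ K = ∅}} ∪
      {s | ∃ U : Set G, IsOpen U ∧ s = {H : ClosedSubgroup G | ((H : Set G) ∩ U).Nonempty}})

/-- The closed subgroup `H` of `G` is confined: the closure of its conjugacy class in the Chabauty
space does not contain the trivial subgroup. -/
def IsConfined {G : Type u} [Group G] [TopologicalSpace G] (H : ClosedSubgroup G) : Prop :=
  ∀ K ∈ closure {L : ClosedSubgroup G |
      ∃ g : G, L.toSubgroup = H.toSubgroup.map (MulAut.conj g).toMonoidHom},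
    K.toSubgroup ≠ ⊥

/-- The closed subgroup `H` of `G` is relatively amenable in `G`: it fixes a (regular) Borel
probability measure on every non-empty compact `G`-space. Every non-empty compact `G`-space
contains the closure of an orbit, which is isomorphic to a compact `G`-space in the universe
of `G`. -/
def IsRelativelyAmenable {G : Type u} [Group G] [TopologicalSpace G] (H : ClosedSubgroup G) :
    Prop :=
  ∀ (Y : Type u) [TopologicalSpace Y] [MulAction G Y] [Nonempty Y] [MeasurableSpace Y]
    [BorelSpace Y], IsCompactSpaceOver G Y →
    ∃ μ : ProbabilityMeasure Y, (μ : Measure Y).Regular ∧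
      ∀ h ∈ H, (μ : Measure Y).map (fun y => h • y) = μ

end Subgroups

end TopDyn

/-! It is enough to find, for each `g ≠ 1`, one boundary on which `g` has no fixed point: the
Furstenberg boundary maps equivariantly onto it, and the image of a point fixed by `g` would be
fixed by `g`. Freeness then excludes a relatively amenable confined `H`. On a free boundary, a
compact `K` not containing `1` moves a small open `O` off itself. Some `g` pushes more than half of
an `H`-invariant measure into `O`, so every element of `gHg⁻¹` sends some point of `O` into `O`;
hence `gHg⁻¹` avoids `K`.

Boundaries are handled through `Concentrates`, which for non-empty compact `G`-spaces amounts to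
being a boundary and lifts along irreducible extensions (`Concentrates.of_irreducible`).

The boundary for `g` is built in two stages. The space `minChoice` of order-like choices of a point
in each clopen set is a boundary, because the rigid stabilizers adjust finitely many values one
after another (`exists_measure_minChoice_lt`). Choose a clopen `α` disjoint from `g • α` and a small
compact open subgroup `W`, so that all of `W g W` sends `α` to `g • α`. Generic choice functions
order `α` and `g • α` incompatibly, so no element of `W g W` fixes them
(`dense_setOf_forall_smul_ne`).

Fixed points may remain on a nowhere dense set. A maximal `W`-invariant open colouring in which `g`
changes colours has dense union (`exists_open_colouring`). Adjoining the colours of all translates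
of a point gives an irreducible extension, still a boundary, on which `g` fixes nothing
(`exists_isBoundary_smul_ne`). -/

namespace TopDyn

open Filter Set

/-! ### Boundaries as spaces on which measures concentrate -/

section Concentration

/-- Every regular probability measure on `Y` can be moved by `G` so that any given non-empty open
set carries almost all of its mass. -/
structure Concentrates (G : Type u) (Y : Type v) [Group G] [TopologicalSpace Y] [MulAction G Y] :
    Prop where
  exists_lt : ∀ [MeasurableSpace Y] [BorelSpace Y] (μ : Measure Y) [IsProbabilityMeasure μ], μ.Regular →
    ∀ O : Set Y, IsOpen O → O.Nonempty → ∀ ε : ENNReal, ε ≠ 0 → ∃ g : G, μ {y | g • y ∉ O} < ε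

theorem regular_map {Y : Type v} {Z : Type w} [TopologicalSpace Y] [MeasurableSpace Y]
    [BorelSpace Y] [TopologicalSpace Z] [T2Space Z] [MeasurableSpace Z] [BorelSpace Z]
    (μ : Measure Y) [IsProbabilityMeasure μ] (hμ : μ.Regular) {f : Y → Z} (hf : Continuous f) :
    (μ.map f).Regular := by
  have := Measure.isProbabilityMeasure_map (μ := μ) hf.measurable.aemeasurable
  have := Measure.InnerRegularCompactLTTop.map_of_continuous (μ := μ) hf
  infer_instance

theorem innerRegular_dirac {Y : Type v} [TopologicalSpace Y] [MeasurableSpace Y] (y : Y) :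
    (Measure.dirac y).InnerRegular := by
  refine ⟨fun s hs r hr => ?_⟩
  rw [Measure.dirac_apply' _ hs] at hr
  by_cases hy : y ∈ s
  · refine ⟨{y}, by simpa using hy, isCompact_singleton, ?_⟩
    rw [Measure.dirac_apply_of_mem (mem_singleton y)]
    simpa [hy] using hr
  · simp [hy] at hr

theorem regular_dirac {Y : Type v} [TopologicalSpace Y] [T2Space Y] [MeasurableSpace Y]
    [BorelSpace Y] (y : Y) : (Measure.dirac y).Regular := by
  have := innerRegular_dirac y
  infer_instance

variable {G : Type u} [Group G]

theorem Concentrates.isMinimal {Y : Type v} [TopologicalSpace Y] [CompactSpace Y] [T2Space Y]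
    [MulAction G Y] (h : Concentrates G Y) : MulAction.IsMinimal G Y := by
  refine ⟨fun y => dense_iff_inter_open.2 fun O hO hne => ?_⟩
  let _ : MeasurableSpace Y := borel Y
  have : BorelSpace Y := ⟨rfl⟩
  obtain ⟨g, hg⟩ := h.exists_lt (Measure.dirac y) (regular_dirac y) O hO hne 1 one_ne_zero
  refine ⟨g • y, ?_, g, rfl⟩
  by_contra hn
  have : y ∈ {z | g • z ∉ O} := hn
  rw [Measure.dirac_apply_of_mem this] at hg
  exact lt_irrefl _ hg

/-- Half the sum of two Dirac masses cannot be pushed into a single point up to mass less than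
`1/2`, because each group element acts injectively. -/
theorem Concentrates.not_isOpen_singleton {Y : Type v} [TopologicalSpace Y] [T2Space Y]
    [MulAction G Y] (h : Concentrates G Y) {y z : Y} (hyz : y ≠ z) : ¬ IsOpen {y} := by
  intro hy
  let _ : MeasurableSpace Y := borel Y
  have : BorelSpace Y := ⟨rfl⟩
  have := innerRegular_dirac y
  have := innerRegular_dirac z
  let μ : Measure Y := (2⁻¹ : ENNReal) • (Measure.dirac y + Measure.dirac z)
  have hμ : IsProbabilityMeasure μ := ⟨by
    simp only [μ, Measure.smul_apply, Measure.add_apply, measure_univ, smul_eq_mul]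
    rw [one_add_one_eq_two]
    exact ENNReal.inv_mul_cancel two_ne_zero ENNReal.ofNat_ne_top⟩
  have hreg : μ.InnerRegular := inferInstance
  obtain ⟨g, hg⟩ := h.exists_lt μ inferInstance {y} hy (singleton_nonempty y) 2⁻¹ (by simp)
  have hle : ∀ x, x = y ∨ x = z → g • x ∉ ({y} : Set Y) → False := by
    intro x hx hgx
    refine absurd hg (not_lt.2 ?_)
    have h1 : Measure.dirac x {x | g • x ∉ ({y} : Set Y)} = 1 := Measure.dirac_apply_of_mem hgx
    simp only [μ, Measure.smul_apply, Measure.add_apply, smul_eq_mul]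
    refine le_mul_of_one_le_right' ?_
    rcases hx with rfl | rfl
    · rw [h1]; exact le_self_add
    · rw [h1]; exact le_add_self
  have h1 : g • y = y := by_contra fun hn => hle y (Or.inl rfl) hn
  have h2 : g • z = y := by_contra fun hn => hle z (Or.inr rfl) hn
  exact hyz (MulAction.injective g (h1.trans h2.symm))

theorem Concentrates.stronglyProximal {Y : Type v} [TopologicalSpace Y] [CompactSpace Y]
    [T2Space Y] [Nonempty Y] [MulAction G Y] [ContinuousConstSMul G Y]
    (h : Concentrates G Y) : StronglyProximal G Y := by
  intro _ _ μ hμ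
  obtain ⟨x⟩ := ‹Nonempty Y›
  refine ⟨x, ?_⟩
  let φ (g : G) : ProbabilityMeasure Y := μ.map (f := fun y => g • y) (by fun_prop)
  -- The net runs over pairs (neighbourhood of `x`, `n`), since `x` need not have a countable
  -- neighbourhood base.
  have key : ∀ p : (TopologicalSpace.OpenNhdsOf x)ᵒᵈ × ℕ, ∃ g : G,
      (φ g : Measure Y) ((OrderDual.ofDual p.1 : TopologicalSpace.OpenNhdsOf x) : Set Y)ᶜ < (p.2 + 1 : ENNReal)⁻¹ := by
    rintro ⟨O, n⟩
    have hO : IsOpen ((OrderDual.ofDual O : TopologicalSpace.OpenNhdsOf x) : Set Y) :=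
      (OrderDual.ofDual O).isOpen
    obtain ⟨g, hg⟩ := h.exists_lt (μ : Measure Y) hμ _ hO ⟨x, (OrderDual.ofDual O).mem⟩
      ((n + 1 : ENNReal)⁻¹) (by simp)
    refine ⟨g, lt_of_eq_of_lt ?_ hg⟩
    rw [ProbabilityMeasure.toMeasure_map, Measure.map_apply (by fun_prop) hO.measurableSet.compl]
    rfl
  choose γ hγ using key
  have hlim : Tendsto (fun p => φ (γ p)) atTop (𝓝 (diracProba x)) := by
    rw [ProbabilityMeasure.tendsto_iff_forall_integral_tendsto]
    intro f
    have hd : ∫ ω, f ω ∂(diracProba x : Measure Y) = f x := by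
      change ∫ ω, f ω ∂(Measure.dirac x) = f x
      exact integral_dirac' _ _ f.continuous.stronglyMeasurable
    rw [hd, Metric.tendsto_nhds]
    intro ε hε
    let O : TopologicalSpace.OpenNhdsOf x := ⟨⟨{y | |f y - f x| < ε / 2},
      isOpen_lt (by fun_prop) continuous_const⟩, by simpa using half_pos hε⟩
    obtain ⟨N, hN⟩ : ∃ N : ℕ, ∀ n ≥ N, 2 * ‖f‖ * ((n : ℝ) + 1)⁻¹ < ε / 2 := by
      have := (tendsto_one_div_add_atTop_nhds_zero_nat (𝕜 := ℝ)).const_mul (2 * ‖f‖)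
      simp only [mul_zero, one_div] at this
      exact eventually_atTop.1 (this.eventually_lt_const (half_pos hε))
    filter_upwards [eventually_ge_atTop (OrderDual.toDual O, N)] with p hp
    set ν : Measure Y := (φ (γ p) : Measure Y) with hν
    have hOp : MeasurableSet (O : Set Y) := O.isOpen.measurableSet
    have hmass : ν.real (O : Set Y)ᶜ ≤ ((p.2 : ℝ) + 1)⁻¹ := by
      have h1 : ν (O : Set Y)ᶜ ≤ ((p.2 + 1 : ℕ) : ENNReal)⁻¹ := by
        refine (measure_mono (compl_subset_compl.2 ?_)).trans ((hγ p).le.trans_eq (by push_cast; rfl))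
        exact hp.1
      have h2 := ENNReal.toReal_mono (by simp) h1
      rw [ENNReal.toReal_inv, ENNReal.toReal_natCast] at h2
      exact_mod_cast h2
    have hint : Integrable (fun y => f y - f x) ν := (f.integrable ν).sub (integrable_const _)
    have hsub : ∫ y, f y ∂ν - f x = ∫ y, (f y - f x) ∂ν := by
      rw [integral_sub (f.integrable ν) (integrable_const _)]
      simp
    have hbound : ∀ y, |f y - f x| ≤ ε / 2 + (O : Set Y)ᶜ.indicator (fun _ => 2 * ‖f‖) y := by
      intro y
      by_cases hy : y ∈ (O : Set Y)
      · rw [indicator_of_notMem (by simpa using hy), add_zero]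
        exact le_of_lt hy
      · rw [indicator_of_mem (by simpa using hy)]
        have h1 := f.norm_coe_le_norm y
        have h2 := f.norm_coe_le_norm x
        rw [Real.norm_eq_abs] at h1 h2
        have := abs_sub (f y) (f x)
        linarith
    rw [Real.dist_eq, hsub]
    calc |∫ y, (f y - f x) ∂ν| ≤ ∫ y, |f y - f x| ∂ν := abs_integral_le_integral_abs
      _ ≤ ∫ y, (ε / 2 + (O : Set Y)ᶜ.indicator (fun _ => 2 * ‖f‖) y) ∂ν :=
        integral_mono hint.abs ((integrable_const _).add
          ((integrable_const _).indicator hOp.compl)) hbound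
      _ = ε / 2 + 2 * ‖f‖ * ν.real (O : Set Y)ᶜ := by
        rw [integral_add (integrable_const _) ((integrable_const _).indicator hOp.compl),
          integral_indicator_const _ hOp.compl]
        simp [mul_comm]
      _ ≤ ε / 2 + 2 * ‖f‖ * ((p.2 : ℝ) + 1)⁻¹ := by gcongr
      _ < ε := by linarith [hN p.2 hp.2]
  refine mem_closure_of_tendsto hlim (Eventually.of_forall fun p => ⟨γ p, ?_⟩)
  exact ProbabilityMeasure.toMeasure_map _ _

theorem Concentrates.isBoundary [TopologicalSpace G] {Y : Type v} [TopologicalSpace Y]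
    [Nonempty Y] [MulAction G Y] (hY : IsCompactSpaceOver G Y) (h : Concentrates G Y) :
    IsBoundary G Y := by
  have := hY.compact
  have := hY.hausdorff
  have := hY.continuous_action
  exact ⟨hY, ‹_›, h.isMinimal, h.stronglyProximal⟩

/-- Strong proximality brings `μ` close to a Dirac mass at some `x`, and minimality then carries `x`
into `O`. A Urysohn function equal to `1` at `x` and vanishing off the preimage of `O` turns weak-*
closeness into a bound on mass. -/
theorem StronglyProximal.concentrates {Y : Type v} [TopologicalSpace Y] [CompactSpace Y]
    [T2Space Y] [MulAction G Y] [ContinuousConstSMul G Y] (hm : MulAction.IsMinimal G Y)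
    (h : StronglyProximal G Y) : Concentrates G Y := by
  refine ⟨fun μ _ hμ O hO hne ε hε => ?_⟩
  obtain ⟨x, hx⟩ := h ⟨μ, ‹_›⟩ hμ
  obtain ⟨k, hk⟩ := hO.exists_smul_mem G x hne
  obtain ⟨f, hf0, hf1, hf01⟩ := exists_continuous_zero_one_of_isClosed
    (s := {y | k • y ∉ O}) (t := {x})
    (isClosed_compl_iff.2 (hO.preimage (continuous_const_smul k))) isClosed_singleton
    (disjoint_singleton_right.2 (by simpa using hk))
  obtain ⟨δ, hδ, hδε⟩ : ∃ δ : ℝ, 0 < δ ∧ ENNReal.ofReal δ ≤ ε := by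
    rcases eq_or_ne ε ⊤ with rfl | hε'
    · exact ⟨1, one_pos, le_top⟩
    · exact ⟨ε.toReal, ENNReal.toReal_pos hε hε', (ENNReal.ofReal_toReal hε').le⟩
  let F : BoundedContinuousFunction Y ℝ := BoundedContinuousFunction.mkOfCompact f
  have hcont : Continuous fun ν : ProbabilityMeasure Y => ∫ y, F y ∂(ν : Measure Y) :=
    continuous_iff_continuousAt.2 fun ν =>
      ProbabilityMeasure.tendsto_iff_forall_integral_tendsto.1 tendsto_id F
  have hopen : IsOpen {ν : ProbabilityMeasure Y | 1 - δ < ∫ y, F y ∂(ν : Measure Y)} :=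
    isOpen_lt continuous_const hcont
  have hd : ∫ ω, F ω ∂(diracProba x : Measure Y) = 1 := by
    change ∫ ω, F ω ∂(Measure.dirac x) = 1
    rw [integral_dirac' _ _ F.continuous.stronglyMeasurable]
    exact hf1 rfl
  obtain ⟨ν, hν, g, hg⟩ := mem_closure_iff.1 hx _ hopen (by
    change 1 - δ < _
    rw [hd]; linarith)
  refine ⟨k * g, ?_⟩
  have hU : MeasurableSet {y | k • y ∉ O} :=
    (isClosed_compl_iff.2 (hO.preimage (continuous_const_smul k))).measurableSet
  have h1 : μ {y | (k * g) • y ∉ O} = (ν : Measure Y) {y | k • y ∉ O} := by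
    rw [hg]
    change _ = Measure.map _ μ _
    rw [Measure.map_apply (by fun_prop) hU]
    simp [mul_smul]
  rw [h1]
  refine lt_of_lt_of_le ?_ hδε
  have h2 : ∫ y, F y ∂(ν : Measure Y) ≤ 1 - (ν : Measure Y).real {y | k • y ∉ O} := by
    rw [← probReal_compl_eq_one_sub hU, ← integral_indicator_one hU.compl]
    refine integral_mono (F.integrable _) ((integrable_const _).indicator hU.compl) fun y => ?_
    by_cases hy : k • y ∉ O
    · have : F y = 0 := hf0 hy
      rw [this]
      exact indicator_nonneg (fun _ _ => zero_le_one) _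
    · rw [indicator_of_mem (by simpa using hy)]
      exact (hf01 y).2
  have h3 : (ν : Measure Y).real {y | k • y ∉ O} < δ := by
    have : 1 - δ < ∫ y, F y ∂(ν : Measure Y) := hν
    linarith
  exact (ENNReal.lt_ofReal_iff_toReal_lt (measure_ne_top _ _)).2 h3

theorem IsBoundary.concentrates [TopologicalSpace G] {Y : Type v} [TopologicalSpace Y]
    [MulAction G Y] (h : IsBoundary G Y) : Concentrates G Y := by
  have := h.compact
  have := h.hausdorff
  have := h.continuous_action
  exact StronglyProximal.concentrates h.minimal h.stronglyProximal

/-- Concentration lifts along irreducible maps. -/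
theorem Concentrates.of_irreducible {Y : Type v} {E : Type w} [TopologicalSpace Y] [T2Space Y]
    [MulAction G Y] [ContinuousConstSMul G Y] [TopologicalSpace E] [MulAction G E]
    (h : Concentrates G Y) (π : E → Y)
    (hπ : Continuous π) (hsmul : ∀ (g : G) (e : E), π (g • e) = g • π e)
    (hirr : ∀ U : Set E, IsOpen U → U.Nonempty → ∃ O : Set Y, IsOpen O ∧ O.Nonempty ∧ π ⁻¹' O ⊆ U) :
    Concentrates G E := by
  refine ⟨fun μ _ hμ U hU hne ε hε => ?_⟩
  let _ : MeasurableSpace Y := borel Y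
  have : BorelSpace Y := ⟨rfl⟩
  obtain ⟨O, hO, hOne, hOU⟩ := hirr U hU hne
  have := Measure.isProbabilityMeasure_map (μ := μ) hπ.measurable.aemeasurable
  obtain ⟨g, hg⟩ := h.exists_lt (μ.map π) (regular_map μ hμ hπ) O hO hOne ε hε
  refine ⟨g, lt_of_le_of_lt ?_ hg⟩
  have hm : MeasurableSet {y | g • y ∉ O} :=
    (isClosed_compl_iff.2 (hO.preimage (continuous_const_smul g))).measurableSet
  rw [Measure.map_apply hπ.measurable hm]
  refine measure_mono fun e he hge => he (hOU ?_)
  change π (g • e) ∈ O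
  rwa [hsmul]

end Concentration

/-! ### Minimal sets and strong proximality in products -/

section Products

theorem exists_minimal_invariant {T : Type v} [TopologicalSpace T] [CompactSpace T] {ι : Type w}
    (act : ι → T → T) {S : Set T} (hS : IsClosed S) (hne : S.Nonempty)
    (hinv : ∀ i, MapsTo (act i) S S) :
    ∃ M ⊆ S, IsClosed M ∧ M.Nonempty ∧ (∀ i, MapsTo (act i) M M) ∧
      ∀ N ⊆ M, IsClosed N → N.Nonempty → (∀ i, MapsTo (act i) N N) → N = M := by
  obtain ⟨M, hMS, hM⟩ := zorn_superset_nonempty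
    {N : Set T | IsClosed N ∧ N.Nonempty ∧ ∀ i, MapsTo (act i) N N} (fun c hc hchain hcne => by
      refine ⟨⋂₀ c, ⟨isClosed_sInter fun N hN => (hc hN).1, ?_, fun i x hx N hN =>
        (hc hN).2.2 i (hx N hN)⟩, fun N hN => sInter_subset_of_mem hN⟩
      exact IsCompact.nonempty_sInter_of_directed_nonempty_isCompact_isClosed (hS := hcne.to_subtype)
        (fun a ha b hb => (hchain.total ha hb).elim (fun h => ⟨a, ha, subset_rfl, h⟩)
          fun h => ⟨b, hb, h, subset_rfl⟩) (fun N hN => (hc hN).2.1)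
        (fun N hN => (hc hN).1.isCompact) (fun N hN => (hc hN).1)) S ⟨hS, hne, hinv⟩
  exact ⟨M, hMS, hM.prop.1, hM.prop.2.1, hM.prop.2.2, fun N hNM h1 h2 h3 =>
    hM.eq_of_subset ⟨h1, h2, h3⟩ hNM⟩

theorem neBot_comap_of_mem_closure_range {T : Type v} [TopologicalSpace T] {ι : Type w} {f : ι → T}
    {x : T} (hx : x ∈ closure (range f)) : (comap f (𝓝 x)).NeBot := by
  refine comap_neBot_iff.2 fun t ht => ?_
  obtain ⟨_, h1, i, rfl⟩ := mem_closure_iff_nhds.1 hx t ht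
  exact ⟨i, h1⟩

variable {G : Type u} [Group G]

theorem continuous_integral {M : Type v} [TopologicalSpace M] [MeasurableSpace M]
    [OpensMeasurableSpace M] (f : BoundedContinuousFunction M ℝ) :
    Continuous fun ν : ProbabilityMeasure M => ∫ m, f m ∂(ν : Measure M) :=
  continuous_iff_continuousAt.2 fun _ =>
    ProbabilityMeasure.tendsto_iff_forall_integral_tendsto.1 tendsto_id f

/-- Strong proximality passes to subsystems of products. -/
theorem stronglyProximal_of_separating {M : Type v} [TopologicalSpace M] [CompactSpace M]
    [T2Space M] [MulAction G M] [ContinuousConstSMul G M] {I : Type*} (Y : I → Type w)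
    [∀ i, TopologicalSpace (Y i)] [∀ i, CompactSpace (Y i)] [∀ i, T2Space (Y i)]
    [∀ i, MulAction G (Y i)] [∀ i, ContinuousConstSMul G (Y i)]
    (hY : ∀ i, StronglyProximal G (Y i)) (π : ∀ i, M → Y i) (hπ : ∀ i, Continuous (π i))
    (hsmul : ∀ i (g : G) m, π i (g • m) = g • π i m)
    (hsep : ∀ m m', (∀ i, π i m = π i m') → m = m') : StronglyProximal G M := by
  intro _ _ μ hμ
  let act (g : G) (ν : ProbabilityMeasure M) : ProbabilityMeasure M :=
    ν.map (f := fun y => g • y) (by fun_prop)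
  have hact_int (g : G) (ν : ProbabilityMeasure M) (f : BoundedContinuousFunction M ℝ) :
      ∫ m, f m ∂(act g ν : Measure M) = ∫ m, f (g • m) ∂(ν : Measure M) := by
    rw [ProbabilityMeasure.toMeasure_map, integral_map (by fun_prop)
      f.continuous.aestronglyMeasurable]
  have hact_cont (g : G) : Continuous (act g) :=
    ProbabilityMeasure.continuous_map (by fun_prop)
  have hact_mul (g h : G) (ν : ProbabilityMeasure M) : act g (act h ν) = act (g * h) ν := by
    apply Subtype.ext
    change Measure.map _ (Measure.map _ _) = Measure.map _ _
    rw [Measure.map_map (by fun_prop) (by fun_prop)]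
    congr 1
    ext m
    simp [mul_smul]
  set S : Set (ProbabilityMeasure M) := closure (range fun g => act g μ) with hS
  obtain ⟨N, hNS, hNc, hNne, hNinv, hNmin⟩ := exists_minimal_invariant act (S := S)
    isClosed_closure (range_nonempty _).closure (fun g => by
      have : MapsTo (act g) (range fun g => act g μ) (range fun g => act g μ) := by
        rintro _ ⟨h, rfl⟩
        exact ⟨g * h, (hact_mul g h μ).symm⟩
      exact this.closure (hact_cont g))
  -- the marginals of the elements of `N` are Dirac masses
  have hmarg : ∀ i, ∀ ν ∈ N, ∃ x : Y i, ∀ f : BoundedContinuousFunction (Y i) ℝ,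
      ∫ m, f (π i m) ∂(ν : Measure M) = f x := by
    intro i
    -- `D` is closed, as a projection along the compact `Y i`, and invariant. Once it meets the
    -- minimal set `N`, it contains `N`; so one `ν` in `N` has all its marginals Dirac at once.
    let D : Set (ProbabilityMeasure M) := {ν | ∃ x : Y i, ∀ f : BoundedContinuousFunction (Y i) ℝ,
      ∫ m, f (π i m) ∂(ν : Measure M) = f x}
    have hcont (f : BoundedContinuousFunction (Y i) ℝ) :
        Continuous fun ν : ProbabilityMeasure M => ∫ m, f (π i m) ∂(ν : Measure M) :=
      continuous_integral (f.compContinuous ⟨π i, hπ i⟩)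
    have hDc : IsClosed D := by
      have : IsClosed {p : ProbabilityMeasure M × Y i |
          ∀ f : BoundedContinuousFunction (Y i) ℝ, ∫ m, f (π i m) ∂(p.1 : Measure M) = f p.2} := by
        simp only [ofPred_forall]
        exact isClosed_iInter fun f => isClosed_eq ((hcont f).comp continuous_fst) (by fun_prop)
      convert isClosedMap_fst_of_compactSpace _ this using 1
      ext ν
      simp [D]
    have hDinv : ∀ g, MapsTo (act g) D D := by
      rintro g ν ⟨x, hx⟩
      refine ⟨g • x, fun f => ?_⟩
      have h1 := hact_int g ν (f.compContinuous ⟨π i, hπ i⟩)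
      have h2 := hx (f.compContinuous ⟨fun y => g • y, by fun_prop⟩)
      simp only [BoundedContinuousFunction.compContinuous_apply, ContinuousMap.coe_mk] at h1 h2
      rw [h1, ← h2]
      simp only [hsmul]
    have hmeet : (N ∩ D).Nonempty := by
      obtain ⟨ν, hν⟩ := hNne
      let _ : MeasurableSpace (Y i) := borel (Y i)
      have : BorelSpace (Y i) := ⟨rfl⟩
      have := Measure.isProbabilityMeasure_map (μ := (ν : Measure M)) (hπ i).measurable.aemeasurable
      -- The marginal of `ν` need not be regular, while strong proximality speaks only of regular
      -- measures; `ρ` is regular and integrates continuous functions in the same way.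
      obtain ⟨ρ, hρreg, hρfin, hρ⟩ :=
        Measure.exists_regular_eq_of_compactSpace ((ν : Measure M).map (π i))
      have hρprob : IsProbabilityMeasure ρ := by
        have := hρ (BoundedContinuousFunction.const _ 1)
        simp only [BoundedContinuousFunction.const_apply, integral_const, smul_eq_mul, mul_one,
          probReal_univ] at this
        exact ⟨by rwa [← ENNReal.toReal_eq_one_iff, eq_comm]⟩
      let ρ' : ProbabilityMeasure (Y i) := ⟨ρ, hρprob⟩
      obtain ⟨x, hx⟩ := hY i ρ' hρreg
      let Φ (g : G) : ProbabilityMeasure (Y i) := ρ'.map (f := fun y => g • y) (by fun_prop)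
      have hrange : {σ : ProbabilityMeasure (Y i) |
          ∃ g : G, (σ : Measure (Y i)) = (ρ' : Measure (Y i)).map (fun y => g • y)} = range Φ := by
        ext σ
        constructor
        · rintro ⟨g, hg⟩
          exact ⟨g, Subtype.ext hg.symm⟩
        · rintro ⟨g, rfl⟩
          exact ⟨g, rfl⟩
      rw [hrange] at hx
      have hne : (comap Φ (𝓝 (diracProba x))).NeBot := neBot_comap_of_mem_closure_range hx
      -- Along one ultrafilter the translates of `ρ` tend to a Dirac mass and those of `ν` converge
      -- by compactness; the limit lies in `N ∩ D`.
      let U : Ultrafilter G := Ultrafilter.of (comap Φ (𝓝 (diracProba x)))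
      have hU : Tendsto Φ U (𝓝 (diracProba x)) :=
        tendsto_comap.mono_left (Ultrafilter.of_le _)
      obtain ⟨ν', -, hν'⟩ := isCompact_univ.ultrafilter_le_nhds (U.map fun g => act g ν)
        (by simp)
      refine ⟨ν', hNc.mem_of_tendsto (f := fun g => act g ν) (b := (U : Filter G)) hν'
        (Eventually.of_forall fun g => hNinv g hν), x, fun f => ?_⟩
      have h1 : Tendsto (fun g => ∫ m, f (π i m) ∂(act g ν : Measure M)) U
          (𝓝 (∫ m, f (π i m) ∂(ν' : Measure M))) := (hcont f).continuousAt.tendsto.comp hν'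
      have h2 := ProbabilityMeasure.tendsto_iff_forall_integral_tendsto.1 hU f
      have hd : ∫ ω, f ω ∂(diracProba x : Measure (Y i)) = f x := by
        change ∫ ω, f ω ∂(Measure.dirac x) = f x
        exact integral_dirac' _ _ f.continuous.stronglyMeasurable
      rw [hd] at h2
      refine tendsto_nhds_unique h1 (h2.congr fun g => ?_)
      have h3 := hact_int g ν (f.compContinuous ⟨π i, hπ i⟩)
      simp only [BoundedContinuousFunction.compContinuous_apply, ContinuousMap.coe_mk, hsmul] at h3
      rw [h3, ProbabilityMeasure.toMeasure_map, integral_map (by fun_prop)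
        f.continuous.aestronglyMeasurable]
      have h4 := hρ (f.compContinuous ⟨fun y => g • y, by fun_prop⟩)
      rw [integral_map (hπ i).aemeasurable (by
        exact (BoundedContinuousFunction.continuous _).aestronglyMeasurable)] at h4
      exact h4.symm
    have := hNmin (N ∩ D) inter_subset_left (hNc.inter hDc) hmeet
      fun g => (hNinv g).inter_inter (hDinv g)
    exact fun ν hν => inter_eq_left.1 this hν
  obtain ⟨ν, hν⟩ := hNne
  choose x hx using fun i => hmarg i ν hν
  have hnull : ∀ i m, π i m ≠ x i → ∃ U ∈ 𝓝 m, (ν : Measure M) U = 0 := by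
    intro i m hm
    obtain ⟨f, hf0, hf1, hf01⟩ := exists_continuous_zero_one_of_isClosed
      (s := {x i}) (t := {π i m}) isClosed_singleton isClosed_singleton (by simpa using hm.symm)
    have h1 := hx i (BoundedContinuousFunction.mkOfCompact f)
    have h2 : (BoundedContinuousFunction.mkOfCompact f) (x i) = 0 := hf0 rfl
    rw [h2] at h1
    have h3 : (fun m => f (π i m)) =ᵐ[(ν : Measure M)] 0 :=
      (integral_eq_zero_iff_of_nonneg (fun m => (hf01 _).1)
        (((BoundedContinuousFunction.mkOfCompact f).compContinuous ⟨π i, hπ i⟩).integrable _)).1 h1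
    refine ⟨{m | f (π i m) ≠ 0}, ?_, h3⟩
    have : IsOpen {m | f (π i m) ≠ 0} := isOpen_ne_fun (by fun_prop) continuous_const
    refine this.mem_nhds ?_
    have : f (π i m) = 1 := hf1 rfl
    simp [this]
  obtain ⟨m₀, hm₀⟩ : ∃ m, ∀ U ∈ 𝓝 m, (ν : Measure M) U ≠ 0 := by
    by_contra! hcon
    have : (ν : Measure M) univ = 0 := isCompact_univ.measure_zero_of_nhdsWithin fun m _ => by
      simpa using hcon m
    simp at this
  have hpt : ∀ m, m ≠ m₀ → ∃ U ∈ 𝓝 m, (ν : Measure M) U = 0 := by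
    intro m hm
    have : ∃ i, π i m ≠ x i := by
      by_contra! hcon
      refine hm (hsep _ _ fun i => ?_)
      rw [hcon]
      by_contra hne
      obtain ⟨U, hU, hU0⟩ := hnull i m₀ (Ne.symm hne)
      exact hm₀ U hU hU0
    obtain ⟨i, hi⟩ := this
    exact hnull i m hi
  -- As `ν` need not be regular, its local nullity off `m₀` is used only on the compact sets where
  -- `f` differs from `f m₀` by at least `1 / (n + 1)`.
  have hae (f : BoundedContinuousFunction M ℝ) : ∫ m, f m ∂(ν : Measure M) = f m₀ := by
    have h1 : ∀ n : ℕ, ∀ᵐ m ∂(ν : Measure M), |f m - f m₀| < 1 / ((n : ℝ) + 1) := by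
      intro n
      have hcl : IsClosed {m | 1 / ((n : ℝ) + 1) ≤ |f m - f m₀|} :=
        isClosed_le continuous_const (by fun_prop)
      have h0 := hcl.isCompact.measure_zero_of_nhdsWithin (μ := (ν : Measure M)) (fun m hm => by
        obtain ⟨U, hU, hU0⟩ := hpt m (by
          rintro rfl
          have : (0 : ℝ) < 1 / ((n : ℝ) + 1) := by positivity
          simp only [sub_self, abs_zero, mem_ofPred_eq] at hm
          linarith)
        exact ⟨U, mem_nhdsWithin_of_mem_nhds hU, hU0⟩)
      rw [ae_iff]
      simpa using h0
    have h2 : ∀ᵐ m ∂(ν : Measure M), f m = f m₀ := by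
      filter_upwards [ae_all_iff.2 h1] with m hm
      have : |f m - f m₀| ≤ 0 := ge_of_tendsto' tendsto_one_div_add_atTop_nhds_zero_nat
        fun n => (hm n).le
      exact sub_eq_zero.1 (abs_nonpos_iff.1 this)
    rw [integral_congr_ae h2]
    simp
  refine ⟨m₀, ?_⟩
  have hνS := hNS hν
  rw [hS] at hνS
  have hne := neBot_comap_of_mem_closure_range hνS
  have hlim : Tendsto (fun g => act g μ) (comap (fun g => act g μ) (𝓝 ν)) (𝓝 (diracProba m₀)) := by
    rw [ProbabilityMeasure.tendsto_iff_forall_integral_tendsto]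
    intro f
    have hd : ∫ ω, f ω ∂(diracProba m₀ : Measure M) = f m₀ := by
      change ∫ ω, f ω ∂(Measure.dirac m₀) = f m₀
      exact integral_dirac' _ _ f.continuous.stronglyMeasurable
    rw [hd, ← hae f]
    exact ProbabilityMeasure.tendsto_iff_forall_integral_tendsto.1 tendsto_comap f
  exact mem_closure_of_tendsto hlim (Eventually.of_forall fun g => ⟨g, rfl⟩)

end Products

/-! ### Existence of the Furstenberg boundary -/

section FurstenbergBoundary

variable {G : Type u} [Group G] [TopologicalSpace G]

theorem IsCompactSpaceOver.subMulAction {Z : Type v} [TopologicalSpace Z] [MulAction G Z]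
    (hZ : IsCompactSpaceOver G Z) (S : SubMulAction G Z) (hS : IsClosed (S : Set Z)) :
    IsCompactSpaceOver G S := by
  have := hZ.compact
  have := hZ.hausdorff
  have := hZ.continuous_action
  refine ⟨isCompact_iff_compactSpace.1 hS.isCompact, inferInstance, ⟨?_⟩⟩
  exact Continuous.subtype_mk (f := fun p : G × S => p.1 • (p.2 : Z)) (by fun_prop) _

/-- Every boundary is isomorphic to one that is carried by a quotient of `Ultrafilter G`. -/
theorem IsBoundary.exists_model {Y : Type v} [TopologicalSpace Y] [MulAction G Y]
    (hY : IsBoundary G Y) : ∃ (s : Setoid (Ultrafilter G)) (_ : TopologicalSpace (Quotient s))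
      (_ : MulAction G (Quotient s)), IsBoundary G (Quotient s) ∧
        ∃ e : Quotient s ≃ₜ Y, ∀ (g : G) x, e (g • x) = g • e x := by
  have := hY.compact
  have := hY.hausdorff
  have := hY.continuous_action
  obtain ⟨y⟩ := hY.nonempty
  -- Limits along ultrafilters extend the orbit map of `y`; density of the orbit makes the extension
  -- surjective. This bounds the size of all boundaries.
  have hlim : ∀ U : Ultrafilter G, ∃ z : Y, Tendsto (fun g : G => g • y) U (𝓝 z) := fun U => by
    obtain ⟨z, -, hz⟩ := isCompact_univ.ultrafilter_le_nhds (U.map fun g : G => g • y) (by simp)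
    exact ⟨z, hz⟩
  choose f hf using hlim
  have hsurj : Function.Surjective f := by
    intro z
    have := neBot_comap_of_mem_closure_range (hY.minimal.dense_orbit y z)
    refine ⟨Ultrafilter.of (comap (fun g : G => g • y) (𝓝 z)), ?_⟩
    exact tendsto_nhds_unique (hf _) (tendsto_comap.mono_left (Ultrafilter.of_le _))
  let e₀ : Quotient (Setoid.ker f) ≃ Y := Setoid.quotientKerEquivOfSurjective f hsurj
  let _ : TopologicalSpace (Quotient (Setoid.ker f)) := TopologicalSpace.induced e₀ inferInstance
  let _ : MulAction G (Quotient (Setoid.ker f)) := e₀.mulAction G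
  let e : Quotient (Setoid.ker f) ≃ₜ Y := e₀.toHomeomorphOfIsInducing ⟨rfl⟩
  have he : ∀ (g : G) x, e (g • x) = g • e x := fun g x => e₀.apply_symm_apply _
  refine ⟨Setoid.ker f, inferInstance, inferInstance, ?_, e, he⟩
  have : Nonempty (Quotient (Setoid.ker f)) := ⟨e.symm y⟩
  refine Concentrates.isBoundary ⟨e.symm.compactSpace, e.symm.t2Space, ⟨?_⟩⟩
    (hY.concentrates.of_irreducible e e.continuous he fun U hU hne =>
      ⟨e '' U, e.isOpenMap U hU, hne.image e, (e.injective.preimage_image U).subset⟩)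
  rw [e.isInducing.continuous_iff]
  have : (e ∘ fun p : G × Quotient (Setoid.ker f) => p.1 • p.2) = fun p => p.1 • e p.2 :=
    funext fun p => he _ _
  rw [this]
  fun_prop

variable (G) in
/-- A boundary that is carried by a quotient of `Ultrafilter G`. -/
structure BoundaryModel where
  rel : Setoid (Ultrafilter G)
  top : TopologicalSpace (Quotient rel)
  act : MulAction G (Quotient rel)
  isBoundary : IsBoundary G (Quotient rel)

/-- The underlying space of a boundary model. -/
def BoundaryModel.Carrier (B : BoundaryModel G) : Type u := Quotient B.rel

instance (B : BoundaryModel G) : TopologicalSpace B.Carrier := B.top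

instance (B : BoundaryModel G) : MulAction G B.Carrier := B.act

theorem BoundaryModel.isBoundary_carrier (B : BoundaryModel G) : IsBoundary G B.Carrier :=
  B.isBoundary

/-- A minimal closed invariant set in the product of all boundary models. Its coordinates separate
points, which gives strong proximality, and each coordinate map is onto because its target is
minimal. -/
theorem exists_isFurstenbergBoundary :
    ∃ (F : Type u) (_ : TopologicalSpace F) (_ : MulAction G F), IsFurstenbergBoundary G F := by
  have (B : BoundaryModel G) : CompactSpace B.Carrier := B.isBoundary_carrier.compact
  have (B : BoundaryModel G) : T2Space B.Carrier := B.isBoundary_carrier.hausdorff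
  have (B : BoundaryModel G) : ContinuousSMul G B.Carrier := B.isBoundary_carrier.continuous_action
  have (B : BoundaryModel G) : Nonempty B.Carrier := B.isBoundary_carrier.nonempty
  obtain ⟨M, -, hMc, hMne, hMinv, hMmin⟩ := exists_minimal_invariant
    (T := ∀ B : BoundaryModel G, B.Carrier) (fun (g : G) x => g • x) isClosed_univ univ_nonempty
    (fun g => mapsTo_univ _ _)
  let F : SubMulAction G (∀ B : BoundaryModel G, B.Carrier) := ⟨M, fun g _ hx => hMinv g hx⟩
  have hF : IsCompactSpaceOver G F :=
    IsCompactSpaceOver.subMulAction ⟨inferInstance, inferInstance, inferInstance⟩ F hMc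
  have := hF.compact
  have := hF.hausdorff
  have := hF.continuous_action
  have hFne : Nonempty F := hMne.to_subtype
  have hmin : MulAction.IsMinimal G F := by
    rw [isMinimal_iff_isClosed_smul_invariant]
    intro s hs hinv
    rcases s.eq_empty_or_nonempty with h | h
    · exact Or.inl h
    · right
      have h1 := hMmin (Subtype.val '' s) (by rintro _ ⟨x, -, rfl⟩; exact x.2)
        (hMc.isClosedMap_subtype_val s hs) (h.image _) (by
          rintro g _ ⟨x, hx, rfl⟩
          exact ⟨g • x, hinv g ⟨x, hx, rfl⟩, rfl⟩)
      refine eq_univ_of_forall fun x => ?_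
      have : (x : ∀ B : BoundaryModel G, B.Carrier) ∈ Subtype.val '' s := h1 ▸ x.2
      obtain ⟨x', hx', h'⟩ := this
      rwa [← Subtype.ext h']
  refine ⟨F, inferInstance, inferInstance, ⟨hF, hFne, hmin, ?_⟩, ?_⟩
  · exact stronglyProximal_of_separating BoundaryModel.Carrier
      (fun B => B.isBoundary_carrier.stronglyProximal) (fun B x => x.1 B)
      (fun B => (continuous_apply B).comp continuous_subtype_val) (fun B g x => rfl)
      (fun x x' h => Subtype.ext (funext h))
  · intro Y _ _ hY
    obtain ⟨s, τ, a, hb, e, he⟩ := hY.exists_model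
    let B : BoundaryModel G := ⟨s, τ, a, hb⟩
    let p : F → B.Carrier := fun x => x.1 B
    have hp : Continuous p := (continuous_apply B).comp continuous_subtype_val
    have hsurj : Function.Surjective p := by
      rw [← range_eq_univ]
      have hm := B.isBoundary_carrier.minimal
      refine (eq_empty_or_univ_of_smul_invariant_closed G (isCompact_range hp).isClosed ?_).resolve_left
        (range_nonempty p).ne_empty
      rintro g _ ⟨_, ⟨x, rfl⟩, rfl⟩
      exact ⟨g • x, rfl⟩
    exact ⟨fun x => e (p x), e.continuous.comp hp, e.surjective.comp hsurj,
      fun g x => (he g (p x))⟩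

end FurstenbergBoundary

open scoped Pointwise

/-! ### Function spaces with a twisted action -/

section TwistedFunctions

/-- Functions `I → Z` with the action `(g • f) i = g • f (g⁻¹ • i)`. -/
def TwistedFun (I : Type v) (Z : Type w) := I → Z

instance (I : Type v) (Z : Type w) [TopologicalSpace Z] : TopologicalSpace (TwistedFun I Z) :=
  Pi.topologicalSpace

instance (I : Type v) (Z : Type w) [TopologicalSpace Z] [T2Space Z] : T2Space (TwistedFun I Z) :=
  Pi.t2Space

instance {G : Type u} [Group G] (I : Type v) (Z : Type w) [MulAction G I] [MulAction G Z] :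
    MulAction G (TwistedFun I Z) where
  smul g f := fun i => g • f (g⁻¹ • i)
  one_smul f := funext fun i => by
    change (1 : G) • f ((1 : G)⁻¹ • i) = f i
    simp
  mul_smul g h f := funext fun i => by
    change (g * h) • f ((g * h)⁻¹ • i) = g • h • f (h⁻¹ • g⁻¹ • i)
    simp [mul_smul]

theorem TwistedFun.smul_apply {G : Type u} [Group G] {I : Type v} {Z : Type w} [MulAction G I]
    [MulAction G Z] (g : G) (f : TwistedFun I Z) (i : I) : (g • f) i = g • f (g⁻¹ • i) := rfl

/-- Joint continuity is where open stabilizers enter: `g⁻¹ • i` is locally constant in `g`, so near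
a given `g₀` the coordinate `i` of `g • f` reads a single value of `f`. -/
theorem TwistedFun.isCompactSpaceOver {G : Type u} [Group G] [TopologicalSpace G]
    [IsTopologicalGroup G] {I : Type v} {Z : Type w} [MulAction G I] [MulAction G Z]
    [TopologicalSpace Z] (hI : ∀ i : I, IsOpen (MulAction.stabilizer G i : Set G))
    (hZ : IsCompactSpaceOver G Z) : IsCompactSpaceOver G (TwistedFun I Z) := by
  have := hZ.compact
  have := hZ.hausdorff
  have := hZ.continuous_action
  refine ⟨Function.compactSpace, Pi.t2Space, ⟨continuous_pi fun i => ?_⟩⟩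
  rw [continuous_iff_continuousAt]
  rintro ⟨g₀, f₀⟩
  have hopen : {g : G | g⁻¹ • i = g₀⁻¹ • i} ∈ 𝓝 g₀ := by
    have : {g : G | g⁻¹ • i = g₀⁻¹ • i} =
        (fun g => g₀ * g⁻¹) ⁻¹' (MulAction.stabilizer G i : Set G) := by
      ext g
      simp [MulAction.mem_stabilizer_iff, mul_smul, ← eq_inv_smul_iff]
    rw [this]
    exact ((hI i).preimage (by fun_prop)).mem_nhds (by simp)
  have h1 : ContinuousAt (fun p : G × TwistedFun I Z => p.1 • p.2 (g₀⁻¹ • i)) (g₀, f₀) := by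
    have : Continuous fun p : G × TwistedFun I Z => p.2 (g₀⁻¹ • i) :=
      (continuous_apply (A := fun _ : I => Z) (g₀⁻¹ • i)).comp continuous_snd
    exact (continuous_fst.smul this).continuousAt
  refine h1.congr ?_
  filter_upwards [continuousAt_fst hopen] with p hp
  change _ = p.1 • p.2 (p.1⁻¹ • i)
  rw [show p.1⁻¹ • i = g₀⁻¹ • i from hp]

end TwistedFunctions

/-! ### Open stabilizers and compact open subgroups -/

section StabilizerOpen

variable {G : Type u} [Group G] [TopologicalSpace G] [IsTopologicalGroup G]

theorem isOpen_stabilizer_of_isCompact_isOpen {Z : Type v} [TopologicalSpace Z] [MulAction G Z]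
    [ContinuousSMul G Z] {a : Set Z} (hc : IsCompact a) (ho : IsOpen a) :
    IsOpen (MulAction.stabilizer G a : Set G) := by
  refine Subgroup.isOpen_of_mem_nhds _ (g := 1) ?_
  have h1 : ∀ᶠ g : G in 𝓝 1, ∀ x ∈ a, g • x ∈ a := by
    refine hc.eventually_forall_of_forall_eventually fun x hx => ?_
    have : Continuous fun p : G × Z => p.1 • p.2 := continuous_smul
    exact this.continuousAt.eventually_mem (ho.mem_nhds (by simpa using hx))
  have h2 : ∀ᶠ g : G in 𝓝 1, ∀ x ∈ a, g⁻¹ • x ∈ a :=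
    (continuous_inv.tendsto' (1 : G) 1 inv_one).eventually h1
  filter_upwards [h1, h2] with g hg hg'
  refine MulAction.mem_stabilizer_iff.2 (Subset.antisymm ?_ fun x hx => ?_)
  · rintro _ ⟨x, hx, rfl⟩
    exact hg x hx
  · exact mem_smul_set_iff_inv_smul_mem.2 (hg' x hx)

variable (G) in
/-- Van Dantzig's theorem, one compact open subgroup. -/
theorem exists_isCompact_isOpen_subgroup [LocallyCompactSpace G] [TotallyDisconnectedSpace G] :
    ∃ V : Subgroup G, IsCompact (V : Set G) ∧ IsOpen (V : Set G) := by
  obtain ⟨K, hK, hK1⟩ := exists_compact_mem_nhds (1 : G)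
  obtain ⟨C, hC, h1C, hCK⟩ := loc_compact_Haus_tot_disc_of_zero_dim.mem_nhds_iff.1 hK1
  have hCc : IsCompact C := hK.of_isClosed_subset hC.1 hCK
  -- The stabilizer of `C` under left translation lies in `C`, because `1 ∈ C`.
  have ho := isOpen_stabilizer_of_isCompact_isOpen (G := G) hCc hC.2
  refine ⟨MulAction.stabilizer G C, hCc.of_isClosed_subset (Subgroup.isClosed_of_isOpen _ ho) ?_, ho⟩
  intro g hg
  have : g • (1 : G) ∈ g • C := smul_mem_smul_set h1C
  rw [MulAction.mem_stabilizer_iff.1 hg] at this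
  simpa using this

end StabilizerOpen

theorem mem_rigidStabilizer_iff {G : Type u} [Group G] {X : Type v} [MulAction G X] {a : Set X}
    {g : G} : g ∈ rigidStabilizer G a ↔ ∀ x ∉ a, g • x = x :=
  mem_fixingSubgroup_iff G

/-! ### The space of order-like choice functions -/

section MinChoice

variable {G : Type u} [Group G] {X : Type v} [TopologicalSpace X]

variable (X) in
/-- The non-empty clopen subsets of `X`. -/
def NClopen := {a : Set X // IsClopen a ∧ a.Nonempty}

instance : SetLike (NClopen X) X := ⟨Subtype.val, Subtype.val_injective⟩

theorem NClopen.isClopen (a : NClopen X) : IsClopen (a : Set X) := a.2.1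

theorem NClopen.nonempty (a : NClopen X) : (a : Set X).Nonempty := a.2.2

instance [MulAction G X] [ContinuousConstSMul G X] : MulAction G (NClopen X) where
  smul g a := ⟨g • (a : Set X), ⟨a.2.1.1.smul g, a.2.1.2.smul g⟩, a.2.2.smul_set⟩
  one_smul a := Subtype.ext (one_smul G (a : Set X))
  mul_smul g h a := Subtype.ext (mul_smul g h (a : Set X))

theorem NClopen.coe_smul [MulAction G X] [ContinuousConstSMul G X] (g : G) (a : NClopen X) :
    ((g • a : NClopen X) : Set X) = g • (a : Set X) := rfl

variable (G X) in
/-- The choice functions `y` on the non-empty clopen subsets that behave like a minimum: if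
`b ⊆ a` contains `y a`, then `y b = y a`. -/
def minChoice [MulAction G X] [ContinuousConstSMul G X] :
    SubMulAction G (TwistedFun (NClopen X) X) where
  carrier := {y | (∀ a : NClopen X, y a ∈ a) ∧ ∀ a b : NClopen X, (b : Set X) ⊆ a →
    y a ∈ b → y b = y a}
  smul_mem' := by
    rintro g y ⟨h1, h2⟩
    have hmem : ∀ (a : NClopen X) (x : X), x ∈ g⁻¹ • a ↔ g • x ∈ a := fun a x => by
      change x ∈ g⁻¹ • (a : Set X) ↔ _
      rw [mem_inv_smul_set_iff]
      rfl
    refine ⟨fun a => (hmem a _).1 (h1 _), fun a b hba hb => ?_⟩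
    rw [TwistedFun.smul_apply, TwistedFun.smul_apply, h2 (g⁻¹ • a) (g⁻¹ • b)]
    · exact fun x hx => (hmem a x).2 (hba ((hmem b x).1 hx))
    · exact (hmem b _).2 hb

variable [MulAction G X] [ContinuousConstSMul G X]

theorem isClosed_minChoice [T2Space X] : IsClosed (minChoice G X : Set (TwistedFun (NClopen X) X)) := by
  have hc (a : NClopen X) : Continuous fun y : TwistedFun (NClopen X) X => y a :=
    continuous_apply (A := fun _ : NClopen X => X) a
  have : (minChoice G X : Set (TwistedFun (NClopen X) X)) =
      (⋂ a : NClopen X, {y | y a ∈ (a : Set X)}) ∩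
      ⋂ (a : NClopen X) (b : NClopen X) (_ : (b : Set X) ⊆ a),
        ({y | y a ∈ (b : Set X)ᶜ} ∪ {y | y b = y a}) := by
    ext y
    simp only [minChoice, mem_inter_iff, mem_iInter, mem_union]
    refine and_congr Iff.rfl (forall_congr' fun a => forall_congr' fun b =>
      forall_congr' fun hba => ?_)
    exact imp_iff_not_or
  rw [this]
  refine (isClosed_iInter fun a => a.isClopen.1.preimage (hc a)).inter
    (isClosed_iInter fun a => isClosed_iInter fun b => isClosed_iInter fun _ => ?_)
  exact (b.isClopen.compl.1.preimage (hc a)).union (isClosed_eq (hc b) (hc a))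

-- The minimum for a well-order of `X` is such a choice.
variable (G X) in
theorem nonempty_minChoice : Nonempty (minChoice G X) := by
  have wf : WellFounded (WellOrderingRel (α := X)) := IsWellFounded.wf
  refine ⟨fun a : NClopen X => wf.min a a.nonempty, fun a => wf.min_mem _ _, fun a b hba hb => ?_⟩
  have h1 := wf.not_lt_min (a : Set X) (hba (wf.min_mem (b : Set X) b.nonempty))
  have h2 := wf.not_lt_min (b : Set X) hb
  rcases trichotomous_of WellOrderingRel (wf.min (a : Set X) a.nonempty)
    (wf.min (b : Set X) b.nonempty) with h | h | h
  · exact absurd h h2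
  · exact h.symm
  · exact absurd h h1

theorem continuous_minChoice_apply (a : NClopen X) :
    Continuous fun y : minChoice G X => y.1 a :=
  (continuous_apply (A := fun _ : NClopen X => X) a).comp continuous_subtype_val

instance : ContinuousConstSMul G (minChoice G X) :=
  ⟨fun g => Continuous.subtype_mk (f := fun y : minChoice G X => g • y.1)
    (continuous_pi fun a => (continuous_minChoice_apply (g⁻¹ • a)).const_smul g) _⟩

theorem minChoice_mem (y : minChoice G X) (a : NClopen X) : y.1 a ∈ a := y.2.1 a

theorem minChoice_eq (y : minChoice G X) {a b : NClopen X} (hba : (b : Set X) ⊆ a) (h : y.1 a ∈ b) :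
    y.1 b = y.1 a := y.2.2 a b hba h

theorem minChoice_smul_apply (g : G) (y : minChoice G X) (a : NClopen X) :
    (g • y).1 a = g • y.1 (g⁻¹ • a) := rfl

theorem minChoice_smul_apply_smul (g : G) (y : minChoice G X) (a : NClopen X) :
    (g • y).1 (g • a) = g • y.1 a := by
  rw [minChoice_smul_apply, inv_smul_smul]

theorem smul_eq_of_mem_rigidStabilizer {a : NClopen X} {g : G}
    (hg : g ∈ rigidStabilizer G (a : Set X)) : g • a = a := by
  refine SetLike.ext' ?_
  rw [NClopen.coe_smul]
  refine Subset.antisymm ?_ fun x hx => ?_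
  · rintro _ ⟨x, hx, rfl⟩
    exact smul_mem_of_mem_rigidStabilizer hg hx
  · exact mem_smul_set_iff_inv_smul_mem.2
      (smul_mem_of_mem_rigidStabilizer (inv_mem hg) hx)

end MinChoice

theorem NClopen.isOpen_stabilizer {G : Type u} [Group G] [TopologicalSpace G]
    [IsTopologicalGroup G] {X : Type v} [TopologicalSpace X] [CompactSpace X] [MulAction G X]
    [ContinuousSMul G X] (a : NClopen X) : IsOpen (MulAction.stabilizer G a : Set G) := by
  convert isOpen_stabilizer_of_isCompact_isOpen (G := G) a.isClopen.1.isCompact a.isClopen.2 using 1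
  ext g
  simp only [SetLike.mem_coe, MulAction.mem_stabilizer_iff]
  rw [← NClopen.coe_smul, SetLike.coe_set_eq]

/-! ### The space of choice functions is a boundary -/

section MinChoiceConcentrates

variable {G : Type u} [Group G]
  {X : Type v} [TopologicalSpace X] [CompactSpace X] [T2Space X] [MulAction G X]

theorem PiecewiseMinimalStronglyProximal.concentrates [ContinuousConstSMul G X]
    (hX : PiecewiseMinimalStronglyProximal G X) (a : NClopen X) :
    Concentrates (rigidStabilizer G (a : Set X)) (a : Set X) := by
  have : CompactSpace (a : Set X) := isCompact_iff_compactSpace.1 a.isClopen.1.isCompact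
  have : ContinuousConstSMul (rigidStabilizer G (a : Set X)) (a : Set X) :=
    ⟨fun g => Continuous.subtype_mk (f := fun x : (a : Set X) => (g : G) • (x : X))
      (by fun_prop) _⟩
  exact StronglyProximal.concentrates (hX a a.isClopen a.nonempty).1
    (hX a a.isClopen a.nonempty).2

theorem isCompactSpaceOver_minChoice [TopologicalSpace G] [IsTopologicalGroup G] [ContinuousSMul G X] :
    IsCompactSpaceOver G (minChoice G X) := by
  exact IsCompactSpaceOver.subMulAction (TwistedFun.isCompactSpaceOver NClopen.isOpen_stabilizer
    ⟨inferInstance, inferInstance, inferInstance⟩) _ isClosed_minChoice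

variable [TotallyDisconnectedSpace X] [ContinuousConstSMul G X]

/-- The finite data `J`, `u` describe a basic neighbourhood of `y₀`. With `b` the union of `J` and
`x = y₀ b`, push the law of `y b` into a small clopen `c` around `x`: this settles every `a`
containing `x`, where `y a = y b` as soon as `y b ∈ c ⊆ a`. The sets `a` missing `x` are also missed
by `c`, so the induction corrects them by an element that fixes `c` pointwise. Control of the
support of `r` is part of the statement for this reason. -/
theorem exists_measure_minChoice_lt (hX : PiecewiseMinimalStronglyProximal G X)
    [MeasurableSpace (minChoice G X)] [BorelSpace (minChoice G X)] (y₀ : minChoice G X)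
    (u : NClopen X → Set X) (J : Finset (NClopen X)) :
    (∀ a ∈ J, IsOpen (u a) ∧ y₀.1 a ∈ u a) → ∀ (μ : Measure (minChoice G X))
      [IsProbabilityMeasure μ], μ.Regular → ∀ ε : ENNReal, ε ≠ 0 →
      ∃ r : G, (∀ x, (∀ a ∈ J, x ∉ a) → r • x = x) ∧ μ {y | ∃ a ∈ J, (r • y).1 a ∉ u a} < ε := by
  classical
  have := isClosed_minChoice (G := G) (X := X)
  induction J using Finset.strongInduction with
  | H J ih =>
  intro hJ μ _ hμ ε hε
  rcases J.eq_empty_or_nonempty with rfl | hJne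
  · exact ⟨1, fun x _ => one_smul G x, by simpa using hε.bot_lt⟩
  -- `b` is the union of the members of `J`
  let b : NClopen X := ⟨⋃ a ∈ J, (a : Set X), J.finite_toSet.isClopen_biUnion fun a _ => a.isClopen, by
    obtain ⟨a, ha⟩ := hJne
    obtain ⟨x, hx⟩ := a.nonempty
    exact ⟨x, mem_biUnion ha hx⟩⟩
  have hmemb : ∀ x, x ∈ b ↔ ∃ a ∈ J, x ∈ a := fun x => by
    change x ∈ ⋃ a ∈ J, (a : Set X) ↔ _
    simp
  have hsub : ∀ a ∈ J, (a : Set X) ⊆ b := fun a ha x hx => (hmemb x).2 ⟨a, ha, hx⟩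
  set x := y₀.1 b with hx
  have hxb : x ∈ b := minChoice_mem y₀ b
  obtain ⟨c, hc, hxc, hcO⟩ := compact_exists_isClopen_in_isOpen
    (U := (⋂ a ∈ J, if x ∈ a then u a ∩ a else (a : Set X)ᶜ)) (x := x) (by
      refine isOpen_biInter_finset fun a ha => ?_
      split_ifs
      · exact (hJ a ha).1.inter a.isClopen.2
      · exact a.isClopen.compl.2) (by
      refine mem_iInter₂.2 fun a ha => ?_
      split_ifs with h
      · refine ⟨?_, h⟩
        rw [hx, ← minChoice_eq y₀ (hsub a ha) h]
        exact (hJ a ha).2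
      · exact h)
  have hcO' : ∀ z ∈ c, ∀ a ∈ J, if x ∈ a then z ∈ u a ∧ z ∈ a else z ∉ a := by
    intro z hz a ha
    have := mem_iInter₂.1 (hcO hz) a ha
    split_ifs at this ⊢ with h
    · exact this
    · exact this
  -- the law of `y b` is concentrated on `c` by an element of the rigid stabilizer of `b`
  obtain ⟨r₁, hr₁, hr₁μ⟩ : ∃ r : G, r ∈ rigidStabilizer G (b : Set X) ∧
      μ {y | (r • y).1 b ∉ c} < ε / 2 := by
    let p : minChoice G X → (b : Set X) := fun y => ⟨y.1 b, minChoice_mem y b⟩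
    have hp : Continuous p := (continuous_minChoice_apply b).subtype_mk _
    let _ : MeasurableSpace (b : Set X) := borel _
    have : BorelSpace (b : Set X) := ⟨rfl⟩
    have := Measure.isProbabilityMeasure_map (μ := μ) hp.measurable.aemeasurable
    obtain ⟨r, hr⟩ := (hX.concentrates b).exists_lt (μ.map p) (regular_map μ hμ hp)
      (Subtype.val ⁻¹' c) (hc.2.preimage continuous_subtype_val) ⟨⟨x, hxb⟩, hxc⟩ (ε / 2)
      (by simpa using hε)
    refine ⟨r, r.2, lt_of_le_of_lt ?_ hr⟩
    have hm : MeasurableSet {z : (b : Set X) | r • z ∉ (Subtype.val ⁻¹' c : Set (b : Set X))} := by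
      have hcont : Continuous fun z : (b : Set X) => ((r • z : (b : Set X)) : X) := by
        change Continuous fun z : (b : Set X) => (r : G) • (z : X)
        fun_prop
      exact (hc.compl.preimage hcont).1.measurableSet
    rw [Measure.map_apply hp.measurable hm]
    refine measure_mono fun y hy => ?_
    have h1 : (r : G)⁻¹ • b = b := smul_eq_of_mem_rigidStabilizer (inv_mem r.2)
    change ((r : G) • y).1 b ∉ c at hy
    rw [minChoice_smul_apply, h1] at hy
    exact hy
  let J' := J.filter fun a => x ∉ a
  have hJ' : J' ⊂ J := by
    obtain ⟨a, ha, hxa⟩ := (hmemb x).1 hxb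
    exact Finset.filter_ssubset.2 ⟨a, ha, not_not.2 hxa⟩
  have hcont : Continuous fun y : minChoice G X => r₁ • y :=
    continuous_const_smul r₁
  have := Measure.isProbabilityMeasure_map (μ := μ) hcont.measurable.aemeasurable
  obtain ⟨r₂, hr₂, hr₂μ⟩ := ih J' hJ' (fun a ha => hJ a (hJ'.1 ha)) (μ.map fun y => r₁ • y)
    (regular_map μ hμ hcont) (ε / 2) (by simpa using hε)
  have hr₂b : r₂ ∈ rigidStabilizer G (b : Set X) := mem_rigidStabilizer_iff.2 fun z hz =>
    hr₂ z fun a ha hza => hz (hsub a (hJ'.1 ha) hza)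
  refine ⟨r₂ * r₁, fun z hz => ?_, ?_⟩
  · refine mem_rigidStabilizer_iff.1 (mul_mem hr₂b hr₁) z fun hzb => ?_
    obtain ⟨a, ha, hza⟩ := (hmemb z).1 hzb
    exact hz a ha hza
  have hle : {y : minChoice G X | ∃ a ∈ J, ((r₂ * r₁) • y).1 a ∉ u a} ⊆
      (fun y => r₁ • y) ⁻¹' {y | ∃ a ∈ J', (r₂ • y).1 a ∉ u a} ∪ {y | (r₁ • y).1 b ∉ c} := by
    rintro y ⟨a, ha, hya⟩
    by_contra hcon
    simp only [mem_union, mem_preimage, not_or] at hcon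
    obtain ⟨h1, h2⟩ := hcon
    have h2 : (r₁ • y).1 b ∈ c := not_not.1 h2
    rw [mul_smul] at hya
    by_cases hxa : x ∈ a
    · have hfix : r₂ • (r₁ • y).1 b = (r₁ • y).1 b := hr₂ _ fun a' ha' hmem => by
        have h3 := hcO' _ h2 a' (hJ'.1 ha')
        rw [if_neg (Finset.mem_filter.1 ha').2] at h3
        exact h3 hmem
      have hb : (r₂ • r₁ • y).1 b = (r₁ • y).1 b := by
        rw [minChoice_smul_apply, smul_eq_of_mem_rigidStabilizer (inv_mem hr₂b), hfix]
      have h3 := hcO' _ h2 a ha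
      rw [if_pos hxa, ← hb] at h3
      rw [← minChoice_eq (r₂ • r₁ • y) (hsub a ha) h3.2] at h3
      exact hya h3.1
    · exact h1 ⟨a, Finset.mem_filter.2 ⟨ha, hxa⟩, hya⟩
  refine lt_of_le_of_lt ((measure_mono hle).trans (measure_union_le _ _)) ?_
  rw [← ENNReal.add_halves ε]
  refine ENNReal.add_lt_add ?_ hr₁μ
  refine lt_of_le_of_lt ?_ hr₂μ
  exact Measure.le_map_apply hcont.measurable.aemeasurable _

theorem concentrates_minChoice (hX : PiecewiseMinimalStronglyProximal G X) :
    Concentrates G (minChoice G X) := by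
  refine ⟨fun μ _ hμ O hO hne ε hε => ?_⟩
  obtain ⟨y₀, hy₀⟩ := hne
  obtain ⟨O', hO', rfl⟩ := isOpen_induced_iff.1 hO
  obtain ⟨J, u, hu, hJ⟩ := isOpen_pi_iff.1 hO' y₀.1 hy₀
  obtain ⟨r, -, hr⟩ := exists_measure_minChoice_lt hX y₀ u J hu μ hμ ε hε
  refine ⟨r, lt_of_le_of_lt (measure_mono fun y hy => ?_) hr⟩
  by_contra hcon
  refine hy (hJ fun a ha => ?_)
  by_contra hya
  exact hcon ⟨a, ha, hya⟩

end MinChoiceConcentrates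

/-! ### Choice functions with prescribed smallest points -/

section Prepend

variable {G : Type u} [Group G] {X : Type v} [TopologicalSpace X] [MulAction G X]
  [ContinuousConstSMul G X]

open Classical in
/-- Make the point `x` the smallest one in the choice function `y`. -/
noncomputable def consChoice (x : X) (y : minChoice G X) : minChoice G X :=
  ⟨fun a => if x ∈ a then x else y.1 a, fun a => by
    by_cases h : x ∈ a
    · simp [h]
    · simpa [h] using minChoice_mem y a, fun a b hba hb => by
    by_cases h : x ∈ a
    · simp only [h, if_true] at hb
      simp [h, hb]
    · have h' : x ∉ b := fun hxb => h (hba hxb)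
      simp only [h, if_false] at hb
      simpa [h, h'] using minChoice_eq y hba hb⟩

theorem consChoice_of_mem {x : X} (y : minChoice G X) {a : NClopen X} (h : x ∈ a) :
    (consChoice x y).1 a = x := if_pos h

theorem consChoice_of_notMem {x : X} (y : minChoice G X) {a : NClopen X} (h : x ∉ a) :
    (consChoice x y).1 a = y.1 a := if_neg h

/-- Make the points of the list `L` the smallest ones, in their order. -/
noncomputable def prependChoice (L : List X) (y : minChoice G X) : minChoice G X :=
  L.foldr consChoice y

theorem prependChoice_cons (x : X) (L : List X) (y : minChoice G X) :
    prependChoice (x :: L) y = consChoice x (prependChoice L y) := rfl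

theorem prependChoice_append (L L' : List X) (y : minChoice G X) :
    prependChoice (L ++ L') y = prependChoice L (prependChoice L' y) := List.foldr_append

open Classical in
theorem prependChoice_filter (y : minChoice G X) {a b : NClopen X} (hab : (a : Set X) ⊆ b)
    (L : List X) : (prependChoice (L.filter (· ∈ b)) y).1 a = (prependChoice L y).1 a := by
  induction L with
  | nil => rfl
  | cons x L ih =>
    by_cases hx : x ∈ b
    · rw [List.filter_cons_of_pos (by simpa using hx), prependChoice_cons, prependChoice_cons]
      by_cases hxa : x ∈ a
      · rw [consChoice_of_mem _ hxa, consChoice_of_mem _ hxa]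
      · rw [consChoice_of_notMem _ hxa, consChoice_of_notMem _ hxa, ih]
    · rw [List.filter_cons_of_neg (by simpa using hx), prependChoice_cons,
        consChoice_of_notMem _ fun hxa => hx (hab hxa), ih]

/-- Finitely many values of a choice function are prescribed by a finite list of points. -/
theorem exists_list_prependChoice_eq (y₀ : minChoice G X) (J : Finset (NClopen X)) :
    ∃ L : List X, L.Nodup ∧ (∀ x ∈ L, ∃ a ∈ J, x ∈ a) ∧
      ∀ y : minChoice G X, ∀ a ∈ J, (prependChoice L y).1 a = y₀.1 a := by
  classical
  induction J using Finset.strongInduction with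
  | H J ih =>
  rcases J.eq_empty_or_nonempty with rfl | hJne
  · exact ⟨[], by simp⟩
  -- The head of the list is the value of `y₀` on the union of `J`; it settles every member
  -- containing it and leaves strictly fewer members for the tail.
  let b : NClopen X := ⟨⋃ a ∈ J, (a : Set X), J.finite_toSet.isClopen_biUnion fun a _ => a.isClopen, by
    obtain ⟨a, ha⟩ := hJne
    obtain ⟨x, hx⟩ := a.nonempty
    exact ⟨x, mem_biUnion ha hx⟩⟩
  have hmemb : ∀ x, x ∈ b ↔ ∃ a ∈ J, x ∈ a := fun x => by
    change x ∈ ⋃ a ∈ J, (a : Set X) ↔ _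
    simp
  obtain ⟨a₀, ha₀, hxa₀⟩ := (hmemb _).1 (minChoice_mem y₀ b)
  set x := y₀.1 b with hx
  obtain ⟨L, hL, hLJ, hLy⟩ := ih (J.filter fun a => x ∉ a)
    (Finset.filter_ssubset.2 ⟨a₀, ha₀, not_not.2 hxa₀⟩)
  refine ⟨x :: L, List.nodup_cons.2 ⟨fun h => ?_, hL⟩, fun z hz => ?_, fun y a ha => ?_⟩
  · obtain ⟨a, ha, hxa⟩ := hLJ x h
    exact (Finset.mem_filter.1 ha).2 hxa
  · rcases List.mem_cons.1 hz with rfl | hz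
    · exact ⟨a₀, ha₀, hxa₀⟩
    · obtain ⟨a, ha, hza⟩ := hLJ z hz
      exact ⟨a, (Finset.mem_filter.1 ha).1, hza⟩
  · rw [prependChoice_cons]
    by_cases hxa : x ∈ a
    · rw [consChoice_of_mem _ hxa, minChoice_eq y₀ (fun z hz => (hmemb z).2 ⟨a, ha, hz⟩) hxa]
    · rw [consChoice_of_notMem _ hxa, hLy y a (Finset.mem_filter.2 ⟨ha, hxa⟩)]

/-- An element that intertwines two choice functions matches their smallest points. -/
theorem map_smul_eq_of_intertwine [CompactSpace X] [T2Space X] [TotallyDisconnectedSpace X]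
    (k : G) (y y' : minChoice G X) (α : NClopen X) (A : List X) :
    ∀ (B : List X) (S : Set X), S.Finite → A.Nodup → B.Nodup → A.length = B.length →
      (∀ x ∈ A, x ∈ α ∧ x ∉ S) → (∀ z ∈ B, k⁻¹ • z ∈ α ∧ k⁻¹ • z ∉ S) →
      (∀ a : NClopen X, (a : Set X) ⊆ α → Disjoint (a : Set X) S →
        (prependChoice B y').1 (k • a) = k • (prependChoice A y).1 a) →
      A.map (k • ·) = B := by
  induction A with
  | nil =>
    intro B S _ _ _ hlen _ _ _
    exact (List.length_eq_zero_iff.1 hlen.symm).symm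
  | cons x A ih =>
    intro B S hS hA hB hlen hAS hBS hint
    obtain _ | ⟨z, B⟩ := B
    · simp at hlen
    have hopen : IsOpen ((α : Set X) ∩ Sᶜ) := α.isClopen.2.inter hS.isClosed.isOpen_compl
    obtain ⟨c, hc, hxc, hcO⟩ := compact_exists_isClopen_in_isOpen hopen (hAS x (by simp))
    obtain ⟨d, hd, hzd, hdO⟩ := compact_exists_isClopen_in_isOpen hopen (hBS z (by simp))
    -- `a` contains both `x` and `k⁻¹ • z`, and avoids the points `S` already matched. The two
    -- choices therefore take the values `x` on `a` and `z` on `k • a`, which forces `k • x = z`.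
    let a : NClopen X := ⟨c ∪ d, hc.union hd, x, Or.inl hxc⟩
    have hmem : ∀ (a : NClopen X) (w : X), w ∈ k • a ↔ k⁻¹ • w ∈ a := fun a w => by
      change w ∈ k • (a : Set X) ↔ _
      exact mem_smul_set_iff_inv_smul_mem
    have hkx : k • x = z := by
      have hsub : (a : Set X) ⊆ (α : Set X) ∩ Sᶜ := union_subset hcO hdO
      have h := hint a (hsub.trans inter_subset_left)
        (disjoint_left.2 fun w hw => (hsub hw).2)
      rw [prependChoice_cons, prependChoice_cons, consChoice_of_mem _ ((hmem a z).2 (Or.inr hzd)),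
        consChoice_of_mem (a := a) _ (Or.inl hxc)] at h
      exact h.symm
    have hA' := List.nodup_cons.1 hA
    have hB' := List.nodup_cons.1 hB
    rw [List.map_cons, hkx, ih B (insert x S) (hS.insert x) hA'.2 hB'.2 (by simpa using hlen)]
    · intro w hw
      obtain ⟨h1, h2⟩ := hAS w (by simp [hw])
      refine ⟨h1, ?_⟩
      rintro (rfl | h)
      · exact hA'.1 hw
      · exact h2 h
    · intro w hw
      obtain ⟨h1, h2⟩ := hBS w (by simp [hw])
      refine ⟨h1, ?_⟩
      rintro (h | h)
      · rw [inv_smul_eq_iff, hkx] at h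
        exact hB'.1 (h ▸ hw)
      · exact h2 h
    · intro a ha hdis
      have hxa : x ∉ a := fun h => disjoint_left.1 hdis h (mem_insert _ _)
      have hza : z ∉ k • a := by rwa [hmem, ← hkx, inv_smul_smul]
      have h := hint a ha (hdis.mono_right (subset_insert _ _))
      rwa [prependChoice_cons, prependChoice_cons, consChoice_of_notMem _ hxa,
        consChoice_of_notMem _ hza] at h

end Prepend

/-! ### Choice functions moved by a compact set are dense -/

section Density

variable {G : Type u} [Group G] [TopologicalSpace G]
  {X : Type v} [TopologicalSpace X] [CompactSpace X] [T2Space X] [TotallyDisconnectedSpace X]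
  [MulAction G X] [ContinuousSMul G X]

theorem infinite_of_isOpen_of_forall_not_isOpen_singleton {X : Type v} [TopologicalSpace X]
    [T1Space X] (hX : ∀ x : X, ¬ IsOpen {x}) {O : Set X} (hO : IsOpen O) (hne : O.Nonempty) :
    O.Infinite := by
  intro hfin
  obtain ⟨x, hx⟩ := hne
  refine hX x ?_
  have : O ∩ (O \ {x})ᶜ = {x} := by
    ext z
    simp only [mem_inter_iff, mem_compl_iff, Set.mem_sdiff, mem_singleton_iff, not_and, not_not]
    exact ⟨fun h => h.2 h.1, fun h => by subst h; exact ⟨hx, fun _ => rfl⟩⟩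
  rw [← this]
  exact hO.inter (hfin.subset sdiff_subset).isClosed.isOpen_compl

theorem exists_list_of_infinite {X : Type v} {O : Set X} (hO : O.Infinite) {F : Set X}
    (hF : F.Finite) (n : ℕ) : ∃ L : List X, L.Nodup ∧ L.length = n ∧ ∀ x ∈ L, x ∈ O ∧ x ∉ F := by
  obtain ⟨t, ht, hn⟩ := (hO.sdiff hF).exists_subset_card_eq n
  exact ⟨t.toList, t.nodup_toList, by simpa using hn, fun x hx => ht (by simpa using hx)⟩

/-- If the compact set `K` moves `α` to the disjoint set `β`, then the choice functions that are
not fixed by any element of `K` are dense. -/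
theorem dense_setOf_forall_smul_ne (hX : ∀ x : X, ¬ IsOpen {x}) {K : Set G} (hK : IsCompact K)
    {α β : NClopen X} (hαβ : Disjoint (α : Set X) β) (hKα : ∀ k ∈ K, k • α = β) :
    Dense {y : minChoice G X | ∀ k ∈ K, k • y ≠ y} := by
  classical
  refine dense_iff_inter_open.2 fun O hO ⟨y₀, hy₀⟩ => ?_
  obtain ⟨O', hO', rfl⟩ := isOpen_induced_iff.1 hO
  obtain ⟨J, u, hu, hJ⟩ := isOpen_pi_iff.1 hO' y₀.1 hy₀
  obtain ⟨L, hL, -, hLy⟩ := exists_list_prependChoice_eq y₀ J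
  have hinf {U : Set X} (hU : IsOpen U) (hne : U.Nonempty) : U.Infinite :=
    infinite_of_isOpen_of_forall_not_isOpen_singleton hX hU hne
  have hinfα := hinf α.isClopen.2 α.nonempty
  have hinfβ := hinf β.isClopen.2 β.nonempty
  -- padding
  obtain ⟨P, hP, hPn, hPα⟩ := exists_list_of_infinite hinfα L.finite_toSet
    (L.filter (· ∈ β)).length
  obtain ⟨Q, hQ, hQn, hQβ⟩ := exists_list_of_infinite hinfβ L.finite_toSet
    (L.filter (· ∈ α)).length
  -- two points of `β`, separated by the clopen set `c`
  obtain ⟨z₁, hz₁⟩ := β.nonempty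
  obtain ⟨z₂, hz₂, hz₂₁⟩ := (hinfβ.sdiff (finite_singleton z₁)).nonempty
  obtain ⟨c, hc, hz₁c, hcβ⟩ := compact_exists_isClopen_in_isOpen
    (β.isClopen.2.inter (isClosed_singleton (x := z₂)).isOpen_compl) ⟨hz₁, Ne.symm hz₂₁⟩
  have hFin : {z | z ∈ L ∨ z ∈ Q}.Finite := (L.finite_toSet.union Q.finite_toSet)
  obtain ⟨z, hz, hzF⟩ := ((hinf hc.2 ⟨z₁, hz₁c⟩).sdiff hFin).nonempty
  obtain ⟨z', ⟨hz'β, hz'c⟩, hz'F⟩ := ((hinf (β.isClopen.2.inter hc.compl.2)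
    ⟨z₂, hz₂, fun h => (hcβ h).2 rfl⟩).sdiff hFin).nonempty
  -- two points of `α` that no element of `K` separates by `c`
  have hFin' : {z | z ∈ L ∨ z ∈ P}.Finite := (L.finite_toSet.union P.finite_toSet)
  obtain ⟨x, hx, hxF⟩ := (hinfα.sdiff hFin').nonempty
  have hev : ∀ᶠ x' in 𝓝 x, ∀ k ∈ K, k • x ∈ c → k • x' ∈ c := by
    refine hK.eventually_forall_of_forall_eventually fun k hk => ?_
    have h1 : Continuous fun p : X × G => p.2 • p.1 := by fun_prop
    have h2 : Continuous fun p : X × G => p.2 • x := by fun_prop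
    by_cases hkx : k • x ∈ c
    · filter_upwards [h1.continuousAt.eventually_mem (hc.2.mem_nhds hkx)] with p hp _ using hp
    · filter_upwards [h2.continuousAt.eventually_mem (hc.compl.2.mem_nhds hkx)] with p hp h
      exact absurd h hp
  obtain ⟨V, hV, hVo, hxV⟩ := mem_nhds_iff.1 hev
  obtain ⟨x', ⟨hx'α, hx'V⟩, hx'F⟩ := ((hinf (α.isClopen.2.inter hVo) ⟨x, hx, hxV⟩).sdiff
    (hFin'.insert x)).nonempty
  have hαnβ : ∀ w, w ∈ α → w ∉ β := fun w h1 h2 => disjoint_left.1 hαβ h1 h2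
  have hcβ' : ∀ w, w ∈ c → w ∈ β := fun w h => (hcβ h).1
  have hβnα : ∀ w, w ∈ β → w ∉ α := fun w h1 h2 => disjoint_left.1 hαβ h2 h1
  -- Starting with `L` keeps the choice function in `O`. The padding gives the sublists in `α` and
  -- `β` equal length, ending in `x, x'` and `z, z'`. An element `k` fixing the choice function
  -- matches them in order, so `k • x = z ∈ c` and `k • x' = z' ∉ c`, against the choice of `x'`.
  let M : List X := L ++ (P ++ (Q ++ [x, x', z, z']))
  have hMα : M.filter (· ∈ α) = (L.filter (· ∈ α) ++ P) ++ [x, x'] := by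
    have h1 : P.filter (· ∈ α) = P := List.filter_eq_self.2 fun w hw => by simpa using (hPα w hw).1
    have h2 : Q.filter (· ∈ α) = [] := List.filter_eq_nil_iff.2 fun w hw => by
      simpa using hβnα w (hQβ w hw).1
    have h3 : [x, x', z, z'].filter (· ∈ α) = [x, x'] := by
      simp [show x ∈ α from hx, show x' ∈ α from hx'α, hβnα z (hcβ' z hz),
        hβnα z' hz'β]
    simp only [M, List.filter_append, h1, h2, h3, List.nil_append, List.append_assoc]
  have hMβ : M.filter (· ∈ β) = (L.filter (· ∈ β) ++ Q) ++ [z, z'] := by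
    have h1 : Q.filter (· ∈ β) = Q := List.filter_eq_self.2 fun w hw => by simpa using (hQβ w hw).1
    have h2 : P.filter (· ∈ β) = [] := List.filter_eq_nil_iff.2 fun w hw => by
      simpa using hαnβ w (hPα w hw).1
    have h3 : [x, x', z, z'].filter (· ∈ β) = [z, z'] := by
      simp [hαnβ x hx, hαnβ x' hx'α, hcβ' z hz, show z' ∈ β from hz'β]
    simp only [M, List.filter_append, h1, h2, h3, List.nil_append, List.append_assoc]
  refine ⟨prependChoice M y₀, hJ fun a ha => ?_, fun k hk hky => ?_⟩
  · change (prependChoice (L ++ _) y₀).1 a ∈ u a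
    rw [prependChoice_append, hLy _ a ha]
    exact (hu a ha).2
  have hkα : ∀ w, k⁻¹ • w ∈ α ↔ w ∈ β := fun w => by
    rw [← hKα k hk]
    exact mem_smul_set_iff_inv_smul_mem.symm
  have hnd : ((L.filter (· ∈ α) ++ P) ++ [x, x']).Nodup := by
    refine List.Nodup.append (List.Nodup.append (hL.filter _) hP fun w h1 h2 => ?_) ?_ fun w h1 h2 => ?_
    · exact (hPα w h2).2 (List.mem_filter.1 h1).1
    · simp only [List.nodup_cons, List.mem_singleton, List.not_mem_nil, not_false_eq_true,
        List.nodup_nil, and_self, and_true]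
      rintro rfl
      exact hx'F (mem_insert _ _)
    · have hw : w ∈ L ∨ w ∈ P := (List.mem_append.1 h1).imp (fun h => (List.mem_filter.1 h).1) id
      rcases (by simpa using h2 : w = x ∨ w = x') with rfl | rfl
      · exact hxF hw
      · exact hx'F (Or.inr hw)
  have hnd' : ((L.filter (· ∈ β) ++ Q) ++ [z, z']).Nodup := by
    refine List.Nodup.append (List.Nodup.append (hL.filter _) hQ fun w h1 h2 => ?_) ?_ fun w h1 h2 => ?_
    · exact (hQβ w h2).2 (List.mem_filter.1 h1).1
    · simp only [List.nodup_cons, List.mem_singleton, List.not_mem_nil, not_false_eq_true,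
        List.nodup_nil, and_self, and_true]
      rintro rfl
      exact hz'c hz
    · have hw : w ∈ L ∨ w ∈ Q := (List.mem_append.1 h1).imp (fun h => (List.mem_filter.1 h).1) id
      rcases (by simpa using h2 : w = z ∨ w = z') with rfl | rfl
      · exact hzF hw
      · exact hz'F hw
  have hmap := map_smul_eq_of_intertwine k y₀ y₀ α ((L.filter (· ∈ α) ++ P) ++ [x, x'])
    ((L.filter (· ∈ β) ++ Q) ++ [z, z']) ∅ finite_empty hnd hnd'
    (by simp only [List.length_append, hPn, hQn, List.length_cons]; omega)
    (fun w hw => ⟨by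
      rw [← hMα] at hw
      simpa using (List.mem_filter.1 hw).2, notMem_empty _⟩)
    (fun w hw => ⟨by
      rw [← hMβ] at hw
      exact (hkα w).2 (by simpa using (List.mem_filter.1 hw).2), notMem_empty _⟩)
    (fun a ha _ => by
      have hka : ((k • a : NClopen X) : Set X) ⊆ β := by
        rw [← hKα k hk]
        exact smul_set_mono ha
      rw [← hMα, ← hMβ, prependChoice_filter _ hka, prependChoice_filter _ ha,
        ← minChoice_smul_apply_smul, hky])
  rw [List.map_append] at hmap
  have htail := (List.append_inj hmap
    (by simp only [List.length_map, List.length_append, hPn, hQn]; omega)).2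
  simp only [List.map_cons, List.map_nil, List.cons.injEq, and_true] at htail
  refine hz'c ?_
  rw [← htail.2]
  exact hV hx'V k hk (htail.1 ▸ hz)

end Density

/-! ### Invariant open colourings -/

section Colouring

variable {G : Type u} [Group G] [TopologicalSpace G]
  {Y : Type v} [TopologicalSpace Y] [T2Space Y] [MulAction G Y] [ContinuousSMul G Y]

theorem exists_isOpen_forall_smul_notMem {K : Set G} (hK : IsCompact K) {y : Y}
    (hy : ∀ k ∈ K, k • y ≠ y) :
    ∃ O : Set Y, IsOpen O ∧ y ∈ O ∧ ∀ k ∈ K, ∀ z ∈ O, k • z ∉ O := by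
  have hev : ∀ᶠ p : Y × Y in 𝓝 (y, y), ∀ k ∈ K, k • p.1 ≠ p.2 := by
    refine hK.eventually_forall_of_forall_eventually fun k hk => ?_
    have hopen : IsOpen {q : (Y × Y) × G | q.2 • q.1.1 ≠ q.1.2} :=
      isOpen_ne_fun (by fun_prop) (by fun_prop)
    exact hopen.mem_nhds (hy k hk)
  rw [nhds_prod_eq] at hev
  obtain ⟨S, hS, hSK⟩ := mem_prod_same_iff.1 hev
  obtain ⟨O, hOS, hO, hyO⟩ := mem_nhds_iff.1 hS
  exact ⟨O, hO, hyO, fun k hk z hz hkz => hSK (mk_mem_prod (hOS hz) (hOS hkz)) k hk rfl⟩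

/-- A Katětov-type colouring lemma: if no double coset translate of `g` has fixed points on a dense
set, then a dense open set splits into finitely many open `W`-invariant pieces that `g` moves off
themselves. -/
theorem exists_open_colouring [IsTopologicalGroup G] [CompactSpace Y] (g : G) {W : Subgroup G}
    (hWc : IsCompact (W : Set G)) (hWo : IsOpen (W : Set G))
    (hd : Dense {y : Y | ∀ k ∈ (W : Set G) * {g} * W, k • y ≠ y}) :
    ∃ (n : ℕ) (A : Fin n → Set Y), (∀ i, IsOpen (A i)) ∧ (∀ i, ∀ w ∈ W, ∀ y ∈ A i, w • y ∈ A i) ∧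
      (∀ i j, i ≠ j → Disjoint (A i) (A j)) ∧ (∀ i, ∀ y ∈ A i, g • y ∉ A i) ∧
      Dense (⋃ i, A i) := by
  set K₀ : Set G := (W : Set G) * {g} * W with hK₀
  have hK₀c : IsCompact K₀ := (hWc.mul isCompact_singleton).mul hWc
  have hmemK₀ : ∀ w ∈ W, ∀ w' ∈ W, w * g * w' ∈ K₀ := fun w hw w' hw' =>
    mul_mem_mul (mul_mem_mul hw rfl) hw'
  -- Symmetrized, because a colour conflict with a point arises both from its image and from its
  -- preimage under `g`.
  let K : Set G := K₀ ∪ K₀⁻¹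
  have hKc : IsCompact K := hK₀c.union hK₀c.inv
  obtain ⟨T, hT⟩ := hKc.elim_finite_subcover (fun t : G => (fun k => k * t⁻¹) ⁻¹' (W : Set G))
    (fun t => hWo.preimage (by fun_prop)) (fun k _ => mem_iUnion.2 ⟨k, by simp⟩)
  -- Colours are `W`-invariant and `K ⊆ ⋃ t ∈ T, W t`, so the `K`-neighbours of a point show at most
  -- `T.card` colours; one more always leaves a free colour.
  refine ⟨T.card + 1, ?_⟩
  let s : Set (Fin (T.card + 1) → Set Y) := {A | (∀ i, IsOpen (A i)) ∧
    (∀ i, ∀ w ∈ W, ∀ y ∈ A i, w • y ∈ A i) ∧ (∀ i j, i ≠ j → Disjoint (A i) (A j)) ∧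
    (∀ i, ∀ y ∈ A i, g • y ∉ A i)}
  obtain ⟨A, hA⟩ := zorn_le₀ s (fun c hcs hc => by
    have hdir : ∀ B ∈ c, ∀ B' ∈ c, ∃ C ∈ c, B ≤ C ∧ B' ≤ C := fun B hB B' hB' =>
      (hc.total hB hB').elim (fun h => ⟨B', hB', h, le_rfl⟩) fun h => ⟨B, hB, le_rfl, h⟩
    refine ⟨fun i => ⋃ B ∈ c, B i, ⟨fun i => isOpen_biUnion fun B hB => (hcs hB).1 i, ?_, ?_, ?_⟩,
      fun B hB i => subset_biUnion_of_mem (u := fun B : Fin (T.card + 1) → Set Y => B i) hB⟩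
    · intro i w hw y hy
      obtain ⟨B, hB, hyB⟩ := mem_iUnion₂.1 hy
      exact mem_biUnion hB ((hcs hB).2.1 i w hw y hyB)
    · intro i j hij
      refine disjoint_left.2 fun y hy hy' => ?_
      obtain ⟨B, hB, hyB⟩ := mem_iUnion₂.1 hy
      obtain ⟨B', hB', hyB'⟩ := mem_iUnion₂.1 hy'
      obtain ⟨C, hC, h1, h2⟩ := hdir B hB B' hB'
      exact disjoint_left.1 ((hcs hC).2.2.1 i j hij) (h1 i hyB) (h2 j hyB')
    · intro i y hy hy'
      obtain ⟨B, hB, hyB⟩ := mem_iUnion₂.1 hy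
      obtain ⟨B', hB', hyB'⟩ := mem_iUnion₂.1 hy'
      obtain ⟨C, hC, h1, h2⟩ := hdir B hB B' hB'
      exact (hcs hC).2.2.2 i y (h1 i hyB) (h2 i hyB'))
  obtain ⟨hAo, hAW, hAd, hAg⟩ := hA.prop
  refine ⟨A, hAo, hAW, hAd, hAg, dense_iff_inter_open.2 fun O hO hne => ?_⟩
  by_contra hcon
  have hOA : ∀ i, ∀ y ∈ O, y ∉ A i := fun i y hy hyA => hcon ⟨y, hy, mem_iUnion.2 ⟨i, hyA⟩⟩
  let U (i : Fin (T.card + 1)) : Set Y := ⋃ k ∈ K, (fun y => k • y) ⁻¹' A i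
  have hmemU : ∀ i y, y ∈ U i ↔ ∃ k ∈ K, k • y ∈ A i := fun i y => by simp [U]
  have hUo : ∀ i, IsOpen (U i) := fun i =>
    isOpen_biUnion fun k _ => (hAo i).preimage (continuous_const_smul k)
  -- by maximality every colour occurs next to points of `O`
  have hUO : ∀ i, ∀ O₁ ⊆ O, IsOpen O₁ → O₁.Nonempty → (O₁ ∩ U i).Nonempty := by
    intro i O₁ hO₁O hO₁ hO₁ne
    by_contra hno
    have hno : ∀ k ∈ K, ∀ z ∈ O₁, k • z ∉ A i := fun k hk z hz hkz =>
      hno ⟨z, hz, (hmemU i z).2 ⟨k, hk, hkz⟩⟩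
    obtain ⟨y, hyO₁, hyN⟩ := hd.inter_open_nonempty O₁ hO₁ hO₁ne
    obtain ⟨O₂, hO₂, hyO₂, hO₂K⟩ := exists_isOpen_forall_smul_notMem hK₀c hyN
    -- Colour classes must be `W`-invariant, so the whole `W`-saturation is added to colour `i`. If
    -- `g` returned a point of it to itself, some `w' * g * w⁻¹` would return a point of `O₂` to
    -- `O₂`; this is why the full double coset appears in the hypothesis.
    let O' : Set Y := ⋃ w ∈ W, (fun y => w • y) ⁻¹' (O₂ ∩ O₁)
    have hmemO' : ∀ y, y ∈ O' ↔ ∃ w ∈ W, w • y ∈ O₂ ∩ O₁ := fun y => by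
      simp only [O', mem_iUnion, mem_preimage, exists_prop]
    have hO'o : IsOpen O' := isOpen_biUnion fun w _ =>
      (hO₂.inter hO₁).preimage (continuous_const_smul w)
    have hO'A : ∀ j, ∀ z ∈ O', z ∉ A j := by
      intro j z hz hzj
      obtain ⟨w, hw, hwz⟩ := (hmemO' z).1 hz
      exact hOA j _ (hO₁O hwz.2) (hAW j w hw z hzj)
    have hle : A ≤ Function.update A i (A i ∪ O') := by
      intro j
      by_cases hj : j = i
      · subst hj
        simp
      · simp [Function.update_of_ne hj]
    have hupd : ∀ j z, z ∈ Function.update A i (A i ∪ O') j ↔ z ∈ A j ∨ (j = i ∧ z ∈ O') := by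
      intro j z
      by_cases hj : j = i
      · subst hj
        simp
      · simp [hj]
    have hs : Function.update A i (A i ∪ O') ∈ s := by
      refine ⟨fun j => ?_, fun j w hw z hz => ?_, fun j j' hjj' => ?_, fun j z hz hgz => ?_⟩
      · by_cases hj : j = i
        · subst hj
          simpa using (hAo j).union hO'o
        · simpa [Function.update_of_ne hj] using hAo j
      · rw [hupd] at hz ⊢
        refine hz.imp (hAW j w hw z) (And.imp_right fun hz => ?_)
        obtain ⟨w', hw', hwz⟩ := (hmemO' z).1 hz
        exact (hmemO' _).2 ⟨w' * w⁻¹, mul_mem hw' (inv_mem hw), by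
          rwa [mul_smul, inv_smul_smul]⟩
      · refine disjoint_left.2 fun z hz hz' => ?_
        rw [hupd] at hz hz'
        rcases hz with hz | ⟨rfl, hz⟩
        · rcases hz' with hz' | ⟨rfl, hz'⟩
          · exact disjoint_left.1 (hAd j j' hjj') hz hz'
          · exact hO'A j z hz' hz
        · rcases hz' with hz' | ⟨rfl, hz'⟩
          · exact hO'A j' z hz hz'
          · exact hjj' rfl
      · rw [hupd] at hz hgz
        rcases hz with hz | ⟨rfl, hz⟩
        · rcases hgz with hgz | ⟨rfl, hgz⟩
          · exact hAg j z hz hgz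
          · obtain ⟨w, hw, hwz⟩ := (hmemO' _).1 hgz
            refine hno (w * g * 1)⁻¹ (Or.inr (Set.inv_mem_inv.2 (hmemK₀ w hw 1 (one_mem W)))) _
              hwz.2 ?_
            rwa [mul_one, ← mul_smul w g z, inv_smul_smul]
        · obtain ⟨w, hw, hwz⟩ := (hmemO' _).1 hz
          rcases hgz with hgz | ⟨-, hgz⟩
          · refine hno (1 * g * w⁻¹) (Or.inl (hmemK₀ 1 (one_mem W) _ (inv_mem hw))) _ hwz.2 ?_
            rwa [one_mul, mul_smul, inv_smul_smul]
          · obtain ⟨w', hw', hwz'⟩ := (hmemO' _).1 hgz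
            refine hO₂K (w' * g * w⁻¹) (hmemK₀ w' hw' _ (inv_mem hw)) _ hwz.1 ?_
            rw [mul_smul, inv_smul_smul, mul_smul]
            exact hwz'.1
    have hyA : y ∈ A i := hA.le_of_ge hs hle i ((hupd i y).2 (Or.inr ⟨rfl, (hmemO' y).2
      ⟨1, one_mem W, by simpa using ⟨hyO₂, hyO₁⟩⟩⟩))
    exact hOA i y (hO₁O hyO₁) hyA
  -- a point with neighbours of all colours
  have hdense : Dense (⋂ i, (U i ∪ (closure O)ᶜ)) := by
    refine dense_iInter_of_isOpen (fun i => (hUo i).union isClosed_closure.isOpen_compl)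
      fun i => dense_iff_inter_open.2 fun V hV hVne => ?_
    by_cases hVO : (V ∩ O).Nonempty
    · obtain ⟨z, hz, hzU⟩ := hUO i (V ∩ O) inter_subset_right (hV.inter hO) hVO
      exact ⟨z, hz.1, Or.inl hzU⟩
    · obtain ⟨z, hz⟩ := hVne
      exact ⟨z, hz, Or.inr fun hzO => hVO (mem_closure_iff.1 hzO V hV hz)⟩
  obtain ⟨y, hyO, hyU⟩ := hdense.inter_open_nonempty O hO hne
  have hnb : ∀ i, ∃ t ∈ T, t • y ∈ A i := by
    intro i
    have hyi : y ∈ U i := (mem_iInter.1 hyU i).resolve_right fun h => h (subset_closure hyO)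
    obtain ⟨k, hk, hky⟩ := (hmemU i y).1 hyi
    obtain ⟨t, ht, hkt⟩ := mem_iUnion₂.1 (hT hk)
    refine ⟨t, ht, ?_⟩
    have := hAW i _ (inv_mem (show k * t⁻¹ ∈ W from hkt)) _ hky
    rwa [smul_smul, mul_inv_rev, inv_inv, mul_assoc, inv_mul_cancel, mul_one] at this
  choose t htT hty using hnb
  have hinj : Function.Injective fun i => (⟨t i, htT i⟩ : T) := by
    intro i j hij
    by_contra hne
    have : t i = t j := congrArg Subtype.val hij
    exact disjoint_left.1 (hAd i j hne) (hty i) (this ▸ hty j)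
  have := Fintype.card_le_of_injective _ hinj
  simp at this

end Colouring

/-! ### The extension by colours -/

section ColouredExtension

/-- A finite set of colours, with the discrete topology and the trivial action. -/
def Colour (n : ℕ) := Fin n

instance (n : ℕ) : TopologicalSpace (Colour n) := ⊥

instance (n : ℕ) : DiscreteTopology (Colour n) := ⟨rfl⟩

instance (n : ℕ) : Finite (Colour n) := inferInstanceAs (Finite (Fin n))

instance {G : Type u} [Group G] (n : ℕ) : MulAction G (Colour n) where
  smul _ i := i
  one_smul _ := rfl
  mul_smul _ _ _ := rfl

variable {G : Type u} [Group G] {Y : Type v} [MulAction G Y]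

/-- The translate of `A` by a coset of a subgroup that leaves `A` invariant. -/
def cosetTranslate (W : Subgroup G) (A : Set Y) (q : G ⧸ W) : Set Y :=
  {y | q.out⁻¹ • y ∈ A}

theorem mem_cosetTranslate_mk {W : Subgroup G} {A : Set Y}
    (hA : ∀ w ∈ W, ∀ y ∈ A, w • y ∈ A) (h : G) (y : Y) :
    y ∈ cosetTranslate W A (h : G ⧸ W) ↔ h⁻¹ • y ∈ A := by
  obtain ⟨w, hw⟩ := QuotientGroup.mk_out_eq_mul W h
  change (QuotientGroup.mk h : G ⧸ W).out⁻¹ • y ∈ A ↔ _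
  rw [hw, mul_inv_rev, mul_smul]
  exact ⟨fun hy => by simpa using hA w w.2 _ hy, hA _ (inv_mem w.2) _⟩

theorem smul_mem_cosetTranslate_iff {W : Subgroup G} {A : Set Y}
    (hA : ∀ w ∈ W, ∀ y ∈ A, w • y ∈ A) (g : G) (q : G ⧸ W) (y : Y) :
    g • y ∈ cosetTranslate W A q ↔ y ∈ cosetTranslate W A (g⁻¹ • q) := by
  induction q using QuotientGroup.induction_on with
  | H h =>
    rw [MulAction.Quotient.smul_mk, mem_cosetTranslate_mk hA, mem_cosetTranslate_mk hA]
    simp [mul_smul]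

variable [TopologicalSpace Y]

theorem isOpen_cosetTranslate [ContinuousConstSMul G Y] (W : Subgroup G) {A : Set Y}
    (hA : IsOpen A) (q : G ⧸ W) : IsOpen (cosetTranslate W A q) :=
  hA.preimage (continuous_const_smul _)

/-- The extension of `Y` obtained by adjoining the colours `A i` of all translates of a point. -/
def colouredExtension [ContinuousConstSMul G Y] (W : Subgroup G) {n : ℕ} (A : Colour n → Set Y)
    (hA : ∀ i, ∀ w ∈ W, ∀ y ∈ A i, w • y ∈ A i) :
    SubMulAction G (Y × TwistedFun (G ⧸ W) (Colour n)) where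
  carrier := {p | ∀ J : Finset (G ⧸ W), p.1 ∈ closure (⋂ q ∈ J, cosetTranslate W (A (p.2 q)) q)}
  smul_mem' := by
    classical
    intro g p hp J
    have h1 : MapsTo (fun y => g • y)
        (⋂ q ∈ J.image (g⁻¹ • ·), cosetTranslate W (A (p.2 q)) q)
        (⋂ q ∈ J, cosetTranslate W (A ((g • p).2 q)) q) := by
      intro y hy
      refine mem_iInter₂.2 fun q hq => ?_
      rw [smul_mem_cosetTranslate_iff (hA _)]
      exact mem_iInter₂.1 hy (g⁻¹ • q) (Finset.mem_image_of_mem _ hq)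
    exact h1.closure (continuous_const_smul g) (hp _)

theorem isClosed_colouredExtension_aux (W : Subgroup G) {n : ℕ} (A : Colour n → Set Y)
    (J : Finset (G ⧸ W)) :
    IsClosed {p : Y × TwistedFun (G ⧸ W) (Colour n) |
      p.1 ∈ closure (⋂ q ∈ J, cosetTranslate W (A (p.2 q)) q)} := by
  rw [← isOpen_compl_iff, isOpen_iff_mem_nhds]
  intro p hp
  have h1 : ∀ᶠ p' in 𝓝 p, ∀ q ∈ J, p'.2 q = p.2 q := by
    refine (Filter.eventually_all_finset J).2 fun q _ => ?_
    have hc : Continuous fun p' : Y × TwistedFun (G ⧸ W) (Colour n) => p'.2 q :=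
      (continuous_apply (A := fun _ : G ⧸ W => Colour n) q).comp continuous_snd
    exact hc.continuousAt.eventually_mem ((isOpen_discrete {p.2 q}).mem_nhds rfl)
  filter_upwards [h1, continuousAt_fst (isClosed_closure.isOpen_compl.mem_nhds hp)] with p' h2 h3 h4
  have : (⋂ q ∈ J, cosetTranslate W (A (p'.2 q)) q) = ⋂ q ∈ J, cosetTranslate W (A (p.2 q)) q :=
    iInter₂_congr fun q hq => by rw [h2 q hq]
  exact h3 (this ▸ h4)

variable [CompactSpace Y] [T2Space Y]

/-- A boundary has an extension that is again a boundary and on which `g` has no fixed point,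
provided that generically no element of a double coset `W g W` has fixed points. -/
theorem exists_isBoundary_smul_ne [TopologicalSpace G] [IsTopologicalGroup G] [Nonempty Y]
    [ContinuousSMul G Y] (hY : Concentrates G Y) (g : G) {W : Subgroup G}
    (hWc : IsCompact (W : Set G)) (hWo : IsOpen (W : Set G))
    (hd : Dense {y : Y | ∀ k ∈ (W : Set G) * {g} * W, k • y ≠ y}) :
    ∃ (E : Type (max u v)) (_ : TopologicalSpace E) (_ : MulAction G E),
      IsBoundary G E ∧ ∀ e : E, g • e ≠ e := by
  classical
  obtain ⟨n, A, hAo, hAW, hAd, hAg, hAdense⟩ := exists_open_colouring g hWc hWo hd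
  let E := colouredExtension W (A : Colour n → Set Y) hAW
  have hcl : (E : Set (Y × TwistedFun (G ⧸ W) (Colour n))) = ⋂ J : Finset (G ⧸ W),
      {p | p.1 ∈ closure (⋂ q ∈ J, cosetTranslate W (A (p.2 q)) q)} := by
    ext p
    simp only [mem_iInter]
    rfl
  have hEc : IsClosed (E : Set (Y × TwistedFun (G ⧸ W) (Colour n))) := by
    rw [hcl]
    exact isClosed_iInter fun J => isClosed_colouredExtension_aux W A J
  have hopenstab : ∀ q : G ⧸ W, IsOpen (MulAction.stabilizer G q : Set G) := by
    intro q
    induction q using QuotientGroup.induction_on with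
    | H h =>
      have : (MulAction.stabilizer G (h : G ⧸ W) : Set G) = (fun k => h⁻¹ * k * h) ⁻¹' W := by
        ext k
        rw [SetLike.mem_coe, MulAction.mem_stabilizer_iff, MulAction.Quotient.smul_mk, eq_comm,
          QuotientGroup.eq]
        simp [mul_assoc]
      rw [this]
      exact hWo.preimage (by fun_prop)
  have hcol : IsCompactSpaceOver G (Colour n) := ⟨inferInstance, inferInstance, ⟨continuous_snd⟩⟩
  have hT : IsCompactSpaceOver G (TwistedFun (G ⧸ W) (Colour n)) :=
    TwistedFun.isCompactSpaceOver hopenstab hcol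
  have := hT.compact
  have := hT.hausdorff
  have := hT.continuous_action
  have hE : IsCompactSpaceOver G E :=
    IsCompactSpaceOver.subMulAction ⟨inferInstance, inferInstance, inferInstance⟩ E hEc
  have htr : ∀ q : G ⧸ W, Dense (⋃ i, cosetTranslate W (A i) q) := by
    intro q
    have : (⋃ i, cosetTranslate W (A i) q) = (fun y => q.out⁻¹ • y) ⁻¹' ⋃ i, A i := by
      rw [preimage_iUnion]
      rfl
    rw [this]
    exact hAdense.preimage (Homeomorph.smul q.out⁻¹).isOpenMap
  have hEne : Nonempty E := by
    rw [← SetLike.coe_sort_coe, nonempty_coe_sort, hcl]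
    refine IsCompact.nonempty_iInter_of_directed_nonempty_isCompact_isClosed _ ?_ ?_
      (fun J => (isClosed_colouredExtension_aux W A J).isCompact)
      fun J => isClosed_colouredExtension_aux W A J
    · refine directed_of_isDirected_le fun J J' hJJ' p hp => ?_
      exact closure_mono (biInter_subset_biInter_left hJJ') hp
    · intro J
      have h1 : Dense (⋂ q ∈ (J : Set (G ⧸ W)), ⋃ i, cosetTranslate W (A i) q) :=
        dense_biInter_of_isOpen
          (fun q _ => isOpen_iUnion fun i => isOpen_cosetTranslate W (hAo i) q)
          J.countable_toSet fun q _ => htr q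
      obtain ⟨y, hy⟩ := h1.nonempty
      -- Only needed for a default colour `i₀` on the cosets outside `J`.
      obtain ⟨y₁, hy₁⟩ := hAdense.nonempty
      obtain ⟨i₀, -⟩ := mem_iUnion.1 hy₁
      have h2 : ∀ q : G ⧸ W, ∃ i, q ∈ J → y ∈ cosetTranslate W (A i) q := by
        intro q
        by_cases hq : q ∈ J
        · obtain ⟨i, hi⟩ := mem_iUnion.1 (mem_iInter₂.1 hy q hq)
          exact ⟨i, fun _ => hi⟩
        · exact ⟨i₀, fun h => absurd h hq⟩
      choose c hc using h2
      exact ⟨(y, c), subset_closure (mem_iInter₂.2 fun q hq => hc q hq)⟩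
  refine ⟨E, inferInstance, inferInstance, Concentrates.isBoundary hE
    (hY.of_irreducible (fun e : E => e.1.1) (by fun_prop) (fun h e => rfl) ?_), ?_⟩
  · rintro U hU ⟨p, hp⟩
    obtain ⟨U', hU', rfl⟩ := isOpen_induced_iff.1 hU
    obtain ⟨O, V, hO, hV, hpO, hpV, hOV⟩ := isOpen_prod_iff.1 hU' p.1.1 p.1.2 hp
    obtain ⟨J, u, hu, hJ⟩ := isOpen_pi_iff.1 hV p.1.2 hpV
    refine ⟨O ∩ ⋂ q ∈ J, cosetTranslate W (A (p.1.2 q)) q, hO.inter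
      (isOpen_biInter_finset fun q _ => isOpen_cosetTranslate W (hAo _) q),
      mem_closure_iff.1 (p.2 J) O hO hpO, ?_⟩
    rintro e ⟨heO, heJ⟩
    refine hOV (mk_mem_prod heO (hJ fun q hq => ?_))
    have h1 := mem_iInter₂.1 heJ q hq
    -- A point of the extension lying over an open translate of a colour class must carry that
    -- colour, since the closure of a disjoint class misses this open set. This makes the projection
    -- irreducible.
    have h2 := e.2 {q}
    obtain ⟨y, hy1, hy2⟩ := mem_closure_iff.1 h2 _ (isOpen_cosetTranslate W (hAo _) q) h1
    simp only [Finset.mem_singleton, iInter_iInter_eq_left] at hy2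
    have h3 : p.1.2 q = e.1.2 q := by
      by_contra hne
      exact disjoint_left.1 (hAd _ _ hne) hy1 hy2
    rw [← h3]
    exact (hu q hq).2
  · intro e he
    -- A fixed point would carry equal colours at the cosets of `1` and `g⁻¹`, giving a `y` such
    -- that `y` and `g • y` lie in the same class.
    have h1 : ∀ q : G ⧸ W, e.1.2 (g⁻¹ • q) = e.1.2 q := fun q =>
      congrFun (congrArg (fun e : E => e.1.2) he) q
    have h2 := e.2 {((1 : G) : G ⧸ W), ((g⁻¹ : G) : G ⧸ W)}
    obtain ⟨y, hy⟩ := closure_nonempty_iff.1 ⟨_, h2⟩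
    have h3 := mem_iInter₂.1 hy ((1 : G) : G ⧸ W) (by simp)
    have h4 := mem_iInter₂.1 hy ((g⁻¹ : G) : G ⧸ W) (by simp)
    have h5 : e.1.2 ((g⁻¹ : G) : G ⧸ W) = e.1.2 ((1 : G) : G ⧸ W) := by
      rw [← h1 ((1 : G) : G ⧸ W), MulAction.Quotient.smul_mk, smul_eq_mul, mul_one]
    rw [h5] at h4
    replace h3 := (mem_cosetTranslate_mk (hAW _) _ _).1 h3
    replace h4 := (mem_cosetTranslate_mk (hAW _) _ _).1 h4
    rw [inv_one, one_smul] at h3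
    rw [inv_inv] at h4
    exact hAg _ y h3 h4

end ColouredExtension

/-! ### Freeness, and the exclusion of confined subgroups -/

section FreeBoundary

variable {G : Type u} [Group G] [TopologicalSpace G]

theorem exists_isBoundary_smul_ne_of_ne_one [IsTopologicalGroup G]
    [LocallyCompactSpace G] [TotallyDisconnectedSpace G]
    {X : Type v} [TopologicalSpace X] [CompactSpace X] [T2Space X] [TotallyDisconnectedSpace X]
    [MulAction G X] [ContinuousSMul G X] [FaithfulSMul G X]
    (hX : PiecewiseMinimalStronglyProximal G X) {g : G} (hg : g ≠ 1) :
    ∃ (E : Type (max u v)) (_ : TopologicalSpace E) (_ : MulAction G E),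
      IsBoundary G E ∧ ∀ e : E, g • e ≠ e := by
  obtain ⟨x, hx⟩ : ∃ x : X, g • x ≠ x := by
    by_contra! h
    exact hg (FaithfulSMul.eq_of_smul_eq_smul (α := X) fun x => by rw [h x, one_smul])
  have hiso : ∀ z : X, ¬ IsOpen {z} := by
    intro z hz
    obtain ⟨z', hz'⟩ : ∃ z', z ≠ z' := by
      by_contra! h
      exact hx ((h _).symm.trans (h x))
    let a : NClopen X := ⟨univ, isClopen_univ, x, mem_univ x⟩
    refine (hX.concentrates a).not_isOpen_singleton (y := ⟨z, mem_univ z⟩) (z := ⟨z', mem_univ z'⟩)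
      (fun h => hz' (congrArg Subtype.val h)) ?_
    convert hz.preimage (continuous_subtype_val (p := (· ∈ (a : Set X))))
    ext w
    simp [Subtype.ext_iff]
  obtain ⟨U, U', hU, hU', hxU, hxU', hUU'⟩ := t2_separation hx.symm
  obtain ⟨a, ha, hxa, haU⟩ := compact_exists_isClopen_in_isOpen
    (hU.inter (hU'.preimage (continuous_const_smul g))) ⟨hxU, hxU'⟩
  let α : NClopen X := ⟨a, ha, x, hxa⟩
  have hdisj : Disjoint (α : Set X) (g • α : NClopen X) := by
    refine disjoint_left.2 fun z hz hz' => ?_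
    obtain ⟨w, hw, rfl⟩ := hz'
    exact disjoint_left.1 hUU' (haU hz).1 (haU hw).2
  obtain ⟨V, hVc, hVo⟩ := exists_isCompact_isOpen_subgroup G
  have hαo := α.isOpen_stabilizer (G := G)
  have hβo := (g • α).isOpen_stabilizer (G := G)
  let S : Subgroup G := MulAction.stabilizer G α ⊓ MulAction.stabilizer G (g • α)
  have hSo : IsOpen (S : Set G) := hαo.inter hβo
  -- Stabilizing both `α` and `g • α` makes every element of `W g W` send `α` to `g • α`.
  let W : Subgroup G := V ⊓ S
  have hWo : IsOpen (W : Set G) := hVo.inter hSo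
  have hWc : IsCompact (W : Set G) := hVc.inter_right (S.isClosed_of_isOpen hSo)
  have hK : IsCompact ((W : Set G) * {g} * (W : Set G)) := (hWc.mul isCompact_singleton).mul hWc
  have hKα : ∀ k ∈ (W : Set G) * {g} * (W : Set G), k • α = g • α := by
    rintro _ ⟨_, ⟨w, hw, _, rfl, rfl⟩, w', hw', rfl⟩
    simp only [mul_smul]
    rw [MulAction.mem_stabilizer_iff.1 hw'.2.1, MulAction.mem_stabilizer_iff.1 hw.2.2]
  have hY := isCompactSpaceOver_minChoice (G := G) (X := X)
  have := hY.compact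
  have := hY.hausdorff
  have := hY.continuous_action
  have := nonempty_minChoice G X
  exact exists_isBoundary_smul_ne (concentrates_minChoice hX) g hWc hWo
    (dense_setOf_forall_smul_ne hiso hK hdisj hKα)

theorem IsFurstenbergBoundary.isFreeAction {F : Type u} [TopologicalSpace F] [MulAction G F]
    (hF : IsFurstenbergBoundary G F)
    (h : ∀ g : G, g ≠ 1 → ∃ (E : Type w) (_ : TopologicalSpace E) (_ : MulAction G E),
      IsBoundary G E ∧ ∀ e : E, g • e ≠ e) : IsFreeAction G F := by
  intro x
  rw [eq_bot_iff]
  intro g hg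
  by_contra hne
  obtain ⟨E, _, _, hE, hgE⟩ := h g hne
  -- `E` may live in another universe, so universality is applied to its model.
  obtain ⟨s, _, _, hs, e, he⟩ := hE.exists_model
  obtain ⟨f, -, -, hf⟩ := hF.universal _ hs
  refine hgE (e (f x)) ?_
  rw [← he, ← hf, MulAction.mem_stabilizer_iff.1 hg]

/-- A neighbourhood of the trivial subgroup in the Chabauty space contains all closed subgroups
that avoid a suitable compact set. -/
theorem exists_isCompact_of_mem_chabauty {s : Set (ClosedSubgroup G)} {B : ClosedSubgroup G}
    (hB : B.toSubgroup = ⊥)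
    (hs : s ∈ {s | ∃ K : Set G, IsCompact K ∧ s = {H : ClosedSubgroup G | (H : Set G) ∩ K = ∅}} ∪
      {s | ∃ U : Set G, IsOpen U ∧ s = {H : ClosedSubgroup G | ((H : Set G) ∩ U).Nonempty}})
    (hBs : B ∈ s) : ∃ K : Set G, IsCompact K ∧ 1 ∉ K ∧
      ∀ L : ClosedSubgroup G, (∀ k ∈ K, k ∉ L) → L ∈ s := by
  rcases hs with ⟨K, hK, rfl⟩ | ⟨U, hU, rfl⟩
  · refine ⟨K, hK, fun h1 => ?_, fun L hL => ?_⟩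
    · exact (eq_empty_iff_forall_notMem.1 hBs 1) ⟨one_mem B.toSubgroup, h1⟩
    · exact eq_empty_iff_forall_notMem.2 fun k hk => hL k hk.2 hk.1
  · refine ⟨∅, isCompact_empty, notMem_empty 1, fun L _ => ?_⟩
    obtain ⟨b, hb, hbU⟩ := hBs
    have : b = 1 := by
      have : b ∈ B.toSubgroup := hb
      rwa [hB, Subgroup.mem_bot] at this
    exact ⟨1, one_mem L.toSubgroup, this ▸ hbU⟩

/-- If a boundary is free, then no relatively amenable subgroup is confined. -/
theorem IsBoundary.not_isConfined [IsTopologicalGroup G] [T2Space G]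
    {F : Type u} [TopologicalSpace F] [MulAction G F]
    (hF : IsBoundary G F) (hfree : IsFreeAction G F) {H : ClosedSubgroup G}
    (hH : IsRelativelyAmenable H) : ¬ IsConfined H := by
  intro hconf
  have := hF.hausdorff
  have := hF.continuous_action
  have := hF.nonempty
  let _ : MeasurableSpace F := borel F
  have : BorelSpace F := ⟨rfl⟩
  obtain ⟨μ, hμ, hμH⟩ := hH F hF.toIsCompactSpaceOver
  obtain ⟨x⟩ := hF.nonempty
  -- some conjugate of `H` avoids a given compact set that does not contain `1`
  have key : ∀ K : Set G, IsCompact K → 1 ∉ K → ∃ g : G, ∀ h ∈ H, g * h * g⁻¹ ∉ K := by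
    intro K hK h1
    obtain ⟨O, hO, hxO, hOK⟩ := exists_isOpen_forall_smul_notMem hK (y := x) fun k hk hkx => by
      have : k ∈ MulAction.stabilizer G x := hkx
      rw [hfree x, Subgroup.mem_bot] at this
      exact h1 (this ▸ hk)
    -- With the bound `1/2`, the sets where `g • y` and `g • h • y` miss `O` cannot cover `F`, since
    -- by invariance of `μ` they have equal mass.
    obtain ⟨g, hg⟩ := hF.concentrates.exists_lt (μ : Measure F) hμ O hO ⟨x, hxO⟩ 2⁻¹ (by simp)
    refine ⟨g, fun h hh hk => ?_⟩
    have hm : MeasurableSet {y | g • y ∉ O} :=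
      (hO.preimage (continuous_const_smul g)).isClosed_compl.measurableSet
    have h2 : (μ : Measure F) {y | g • h • y ∉ O} < 2⁻¹ := by
      have h3 := congrArg (fun ν : Measure F => ν {y | g • y ∉ O}) (hμH h hh)
      simp only [Measure.map_apply (continuous_const_smul h).measurable hm] at h3
      exact lt_of_eq_of_lt h3 hg
    have h4 : (univ : Set F) ⊆ {y | g • y ∉ O} ∪ {y | g • h • y ∉ O} := by
      intro y _
      by_contra hcon
      simp only [mem_union, not_or] at hcon
      have hy1 : g • y ∈ O := not_not.1 hcon.1
      refine hOK _ hk _ hy1 ?_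
      simpa [mul_smul] using not_not.1 hcon.2
    have h5 := (measure_mono h4).trans (measure_union_le (μ := (μ : Measure F)) _ _)
    rw [measure_univ] at h5
    exact absurd (ENNReal.add_lt_add hg h2) (not_lt.2 (by rwa [ENNReal.inv_two_add_inv_two]))
  let B : ClosedSubgroup G := ⟨⊥, isClosed_singleton⟩
  refine hconf B ?_ rfl
  rw [(TopologicalSpace.isTopologicalBasis_of_subbasis rfl).mem_closure_iff]
  rintro _ ⟨f, ⟨hf, hfS⟩, rfl⟩ hBf
  have hc : ∀ s : Set (ClosedSubgroup G), ∃ K : Set G, s ∈ f → IsCompact K ∧ 1 ∉ K ∧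
      ∀ L : ClosedSubgroup G, (∀ k ∈ K, k ∉ L) → L ∈ s := by
    intro s
    by_cases hs : s ∈ f
    · obtain ⟨K, hK⟩ := exists_isCompact_of_mem_chabauty (B := B) rfl (hfS hs) (hBf s hs)
      exact ⟨K, fun _ => hK⟩
    · exact ⟨∅, fun h => absurd h hs⟩
  choose K hK using hc
  obtain ⟨g, hg⟩ := key (⋃ s ∈ f, K s) (hf.isCompact_biUnion fun s hs => (hK s hs).1) (by
    simp only [mem_iUnion, not_exists]
    exact fun s hs => (hK s hs).2.1)
  let L : ClosedSubgroup G := ⟨H.toSubgroup.map (MulAut.conj g).toMonoidHom, by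
    have : ((H.toSubgroup.map (MulAut.conj g).toMonoidHom : Subgroup G) : Set G) =
        (fun k => g⁻¹ * k * g) ⁻¹' (H : Set G) := by
      ext k
      constructor
      · rintro ⟨h, hh, rfl⟩
        change g⁻¹ * (g * h * g⁻¹) * g ∈ H
        rwa [show g⁻¹ * (g * h * g⁻¹) * g = h by group]
      · intro hk
        exact ⟨_, hk, by simp [mul_assoc]⟩
    change IsClosed ((H.toSubgroup.map (MulAut.conj g).toMonoidHom : Subgroup G) : Set G)
    rw [this]
    exact H.isClosed'.preimage (by fun_prop)⟩
  refine ⟨L, fun s hs => (hK s hs).2.2 L fun k hk hkL => ?_, g, rfl⟩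
  obtain ⟨h, hh, rfl⟩ := hkL
  exact hg h hh (mem_biUnion hs hk)

end FreeBoundary

end TopDyn


theorem theorem1p2 {G : Type u} [Group G] [TopologicalSpace G] [IsTopologicalGroup G]
    [LocallyCompactSpace G] [TotallyDisconnectedSpace G]
    {X : Type v} [TopologicalSpace X] [CompactSpace X] [T2Space X] [TotallyDisconnectedSpace X]
    [MulAction G X] [ContinuousSMul G X] [FaithfulSMul G X]
    (hX : TopDyn.PiecewiseMinimalStronglyProximal G X) :
    (¬ ∃ H : ClosedSubgroup G, TopDyn.IsRelativelyAmenable H ∧ TopDyn.IsConfined H) ∧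
    (∃ (F : Type u) (_ : TopologicalSpace F) (_ : MulAction G F),
      TopDyn.IsFurstenbergBoundary G F) ∧
    (∀ (F : Type u) [TopologicalSpace F] [MulAction G F],
      TopDyn.IsFurstenbergBoundary G F → TopDyn.IsFreeAction G F) := by
  have hfree : ∀ (F : Type u) [TopologicalSpace F] [MulAction G F],
      TopDyn.IsFurstenbergBoundary G F → TopDyn.IsFreeAction G F := fun F _ _ hF =>
    hF.isFreeAction fun g hg => TopDyn.exists_isBoundary_smul_ne_of_ne_one hX hg
  obtain ⟨F, τ, a, hF⟩ := TopDyn.exists_isFurstenbergBoundary (G := G)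
  refine ⟨?_, ⟨F, τ, a, hF⟩, hfree⟩
  rintro ⟨H, hH, hconf⟩
  exact hF.toIsBoundary.not_isConfined (hfree F hF) hH hconf
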